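/- Let $A$ be a $\mathbb Z/2\mathbb Z$-graded complex $C^*$-algebra (not necessarily unital), i.e. a $C^*$-algebra with an involutive $*$-automorphism, and let $\mathcal H=\mathcal H_0\oplus\mathcal H_1$ be a graded complex Hilbert space whose even and odd parts $\mathcal H_0,\mathcal H_1$ are both separable and infinite-dimensional. Let $\mathcal S=C_0(\mathbb R)$ with the grading $f(x)\mapsto f(-x)$, let $\mathcal K(\mathcal H)$ be the compact operators with the diagonal/off-diagonal grading, let $\hat\otimes$ denote the graded maximal tensor product, and let $$\mathbb K(A,\mathcal H)=\operatorname{Hom}(\mathcal S,A\hat\otimes\mathcal K(\mathcal H))$$ be the space of graded $*$-homomorphisms with the point-norm topology, with base point the zero homomorphism $0$. Let $s:\mathbb K(A,\mathcal H)\times\mathbb K(A,\mathcal H)\to\mathbb K(A,\mathcal H\oplus\mathcal H)$ be the sum map, sending $(\varphi,\psi)$ to the composite $$\mathcal S\xrightarrow{\operatorname{dia}}\mathcal S\oplus\mathcal S\xrightarrow{\varphi\oplus\psi}A\hat\otimes\mathcal K(\mathcal H)\oplus A\hat\otimes\mathcal K(\mathcal H)\cong A\hat\otimes(\mathcal K(\mathcal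 H)\oplus\mathcal K(\mathcal H))\xrightarrow{1\hat\otimes\operatorname{inc}}A\hat\otimes\mathcal K(\mathcal H\oplus\mathcal H).$$ For an even unitary $u:\mathcal H\oplus\mathcal H\to\mathcal H$ put $\mu_u(\varphi,\psi)=(1\hat\otimes\operatorname{Ad}(u))\circ s(\varphi,\psi)$, where $\operatorname{Ad}(u)(T)=uTu^*$. Then, for every such $u$, $(\mathbb K(A,\mathcal H),\mu_u,0)$ is a commutative $H$-monoid: $\mu_u$ is continuous, the maps $\mu_u(0,-)$ and $\mu_u(-,0)$ are homotopic to the identity relative to the base point $0$, the maps $(\varphi,\psi,\chi)\mapsto\mu_u(\mu_u(\varphi,\psi),\chi)$ and $(\varphi,\psi,\chi)\mapsto\mu_u(\varphi,\mu_u(\psi,\chi))$ are homotopic relative to the base point $(0,0,0)$, and the maps $(\varphi,\psi)\mapsto\mu_u(\varphi,\psi)$ and $(\varphi,\psi)\mapsto\mu_u(\psi,\varphi)$ are homotopic relative to the base point $(0,0)$. The same holds in the Real case: suppose in addition that $A$ carries a Real structure (an involutive conjugate-linear $*$-automorphism commuting with the grading) and $\mathcal H$ carries a Real structure (a conjugate-linear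 involution $x\mapsto\bar x$ with $\langle\bar x,\bar y\rangle=\overline{\langle x,y\rangle}$, commuting with the grading), that $\mathcal S$, $\mathcal K(\mathcal H)$ and $A\hat\otimes\mathcal K(\mathcal H)$ carry the induced Real structures (pointwise conjugation; $T\mapsto(x\mapsto\overline{T\bar x})$; the tensor product of the Real structures), that $u$ is Real, and that $\mathbb K(A,\mathcal H)$ consists of the graded $*$-homomorphisms that preserve the Real structures. Then $\mu_u$ again makes $(\mathbb K(A,\mathcal H),0)$ a commutative $H$-monoid. -/

import Mathlib

set_option linter.unusedSectionVars false

open scoped TensorProduct ZeroAtInfty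
open UniformSpace

universe u v w

noncomputable section

namespace SpectralK

/-! ## Graded and Real C*-algebras -/

/-- A `ℤ/2`-graded complex C*-algebra: a C*-algebra with an involutive `*`-automorphism. -/
class GradedCStarAlgebra (A : Type u) [NonUnitalCStarAlgebra A] where
  /-- the grading automorphism -/
  grading : A →⋆ₙₐ[ℂ] A
  grading_grading : ∀ a, grading (grading a) = a

/-- A Real structure on a graded C*-algebra: an involutive conjugate-linear `*`-automorphism
commuting with the grading. -/
class RealCStarAlgebra (A : Type u) [NonUnitalCStarAlgebra A] [GradedCStarAlgebra A] where
  /-- the Real structure `a ↦ ā` -/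
  conj : A →ₗ⋆[ℂ] A
  conj_mul : ∀ a b, conj (a * b) = conj a * conj b
  conj_star : ∀ a, conj (star a) = star (conj a)
  conj_conj : ∀ a, conj (conj a) = a
  conj_grading : ∀ a, conj (GradedCStarAlgebra.grading a) = GradedCStarAlgebra.grading (conj a)


section Algebra

variable {A : Type u} {B : Type v}
  [NonUnitalCStarAlgebra A] [GradedCStarAlgebra A]
  [NonUnitalCStarAlgebra B] [GradedCStarAlgebra B]

/-- The grading automorphism of a graded C*-algebra. -/
abbrev gr : A →⋆ₙₐ[ℂ] A := GradedCStarAlgebra.grading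

@[simp] theorem gr_gr (a : A) : gr (gr a) = a := GradedCStarAlgebra.grading_grading a

/-- An element is even if the grading fixes it. -/
def IsEvenElem (a : A) : Prop := gr a = a

/-- An element is odd if the grading negates it. -/
def IsOddElem (a : A) : Prop := gr a = -a

/-- The grading automorphism as a linear map. -/
def grLin : A →ₗ[ℂ] A where
  toFun a := gr a
  map_add' := map_add gr
  map_smul' := map_smul gr

/-- The projection onto the even part. -/
def evenProj : A →ₗ[ℂ] A := (2⁻¹ : ℂ) • (LinearMap.id + grLin)

/-- The projection onto the odd part. -/
def oddProj : A →ₗ[ℂ] A := (2⁻¹ : ℂ) • (LinearMap.id - grLin)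

@[simp] theorem grLin_apply (a : A) : grLin a = gr a := rfl

theorem evenProj_apply (a : A) : evenProj a = (2⁻¹ : ℂ) • (a + gr a) := rfl

theorem oddProj_apply (a : A) : oddProj a = (2⁻¹ : ℂ) • (a - gr a) := rfl

theorem evenProj_add_oddProj (a : A) : evenProj a + oddProj a = a := by
  rw [evenProj_apply, oddProj_apply]; module

theorem isEvenElem_evenProj (a : A) : IsEvenElem (evenProj a) := by
  simp only [IsEvenElem, evenProj_apply, map_smul, map_add, gr_gr, add_comm]

theorem isOddElem_oddProj (a : A) : IsOddElem (oddProj a) := by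
  simp only [IsOddElem, oddProj_apply, map_smul, map_sub, gr_gr]; module

theorem IsEvenElem.evenProj {a : A} (h : IsEvenElem a) : evenProj a = a := by
  rw [evenProj_apply, h]; module

theorem IsEvenElem.oddProj {a : A} (h : IsEvenElem a) : oddProj a = 0 := by
  rw [oddProj_apply, h]; module

theorem IsOddElem.evenProj {a : A} (h : IsOddElem a) : evenProj a = 0 := by
  rw [evenProj_apply, h]; module

theorem IsOddElem.oddProj {a : A} (h : IsOddElem a) : oddProj a = a := by
  rw [oddProj_apply, h]; module

theorem IsEvenElem.mul_even {a b : A} (ha : IsEvenElem a) (hb : IsEvenElem b) :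
    IsEvenElem (a * b) := by
  rw [IsEvenElem, map_mul, ha, hb]

theorem IsEvenElem.mul_odd {a b : A} (ha : IsEvenElem a) (hb : IsOddElem b) :
    IsOddElem (a * b) := by
  rw [IsOddElem, map_mul, ha, hb, mul_neg]

theorem IsOddElem.mul_even {a b : A} (ha : IsOddElem a) (hb : IsEvenElem b) :
    IsOddElem (a * b) := by
  rw [IsOddElem, map_mul, ha, hb, neg_mul]

theorem IsOddElem.mul_odd {a b : A} (ha : IsOddElem a) (hb : IsOddElem b) :
    IsEvenElem (a * b) := by
  rw [IsEvenElem, map_mul, ha, hb, neg_mul_neg]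

theorem IsEvenElem.star {a : A} (ha : IsEvenElem a) : IsEvenElem (star a) := by
  rw [IsEvenElem, map_star, ha]

theorem IsOddElem.star {a : A} (ha : IsOddElem a) : IsOddElem (star a) := by
  rw [IsOddElem, map_star, ha, star_neg]

theorem map_evenProj (φ : A →⋆ₙₐ[ℂ] B) (h : ∀ a, φ (gr a) = gr (φ a)) (a : A) :
    φ (evenProj a) = evenProj (φ a) := by
  simp only [evenProj_apply, map_smul, map_add, h]

theorem map_oddProj (φ : A →⋆ₙₐ[ℂ] B) (h : ∀ a, φ (gr a) = gr (φ a)) (a : A) :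
    φ (oddProj a) = oddProj (φ a) := by
  simp only [oddProj_apply, map_smul, map_sub, h]

/-! ## The algebraic graded tensor product -/

variable (A B) in
/-- The algebraic graded tensor product: the vector space `A ⊗ B`, with the product
`(a ⊗ b)(a' ⊗ b') = (-1)^{|b||a'|} aa' ⊗ bb'` and the involution
`(a ⊗ b)* = (-1)^{|a||b|} a* ⊗ b*` on homogeneous elements. -/
def AlgTensor : Type (max u v) := A ⊗[ℂ] B

namespace AlgTensor

instance : AddCommGroup (AlgTensor A B) := inferInstanceAs (AddCommGroup (A ⊗[ℂ] B))

instance : Module ℂ (AlgTensor A B) := inferInstanceAs (Module ℂ (A ⊗[ℂ] B))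

/-- The elementary tensor `a ⊗ b`. -/
def tmul (a : A) (b : B) : AlgTensor A B := a ⊗ₜ[ℂ] b

theorem tmul_add (a : A) (b b' : B) : tmul a (b + b') = tmul a b + tmul a b' :=
  TensorProduct.tmul_add a b b'

@[simp] theorem tmul_zero (a : A) : tmul a (0 : B) = 0 :=
  TensorProduct.tmul_zero B a

@[elab_as_elim]
theorem induction_on {p : AlgTensor A B → Prop} (x : AlgTensor A B) (zero : p 0)
    (tmul : ∀ a b, p (tmul a b)) (add : ∀ x y, p x → p y → p (x + y)) : p x :=
  TensorProduct.induction_on x zero tmul add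

/-- Induction over elementary tensors whose second factor is homogeneous. -/
@[elab_as_elim]
theorem induction_hom {p : AlgTensor A B → Prop} (x : AlgTensor A B) (zero : p 0)
    (even : ∀ a b, IsEvenElem b → p (tmul a b)) (odd : ∀ a b, IsOddElem b → p (tmul a b))
    (add : ∀ x y, p x → p y → p (x + y)) : p x := by
  refine induction_on x zero (fun a b => ?_) add
  rw [← evenProj_add_oddProj b, tmul_add]
  exact add _ _ (even _ _ (isEvenElem_evenProj b)) (odd _ _ (isOddElem_oddProj b))

/-- The bilinear multiplication
`(a ⊗ b)(a' ⊗ b') = aa' ⊗ b₀b' + aε(a') ⊗ b₁b'`, where `b = b₀ + b₁` is the decomposition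
into the even and the odd part. -/
def mulLin : AlgTensor A B →ₗ[ℂ] AlgTensor A B →ₗ[ℂ] AlgTensor A B :=
  let m : A ⊗[ℂ] B →ₗ[ℂ] A ⊗[ℂ] B →ₗ[ℂ] A ⊗[ℂ] B :=
    TensorProduct.map₂ (LinearMap.mul ℂ A) (LinearMap.mul ℂ B)
  m ∘ₗ TensorProduct.map LinearMap.id evenProj +
    (m ∘ₗ TensorProduct.map LinearMap.id oddProj).compl₂
      (TensorProduct.map grLin LinearMap.id)

/-- The conjugate-linear involution `(a ⊗ b)* = a* ⊗ b₀* + ε(a)* ⊗ b₁*`. -/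
def starLin : AlgTensor A B →ₗ⋆[ℂ] AlgTensor A B :=
  (TensorProduct.map (starLinearEquiv ℂ : A ≃ₗ⋆[ℂ] A).toLinearMap
      (starLinearEquiv ℂ : B ≃ₗ⋆[ℂ] B).toLinearMap).comp
    (TensorProduct.map LinearMap.id evenProj + TensorProduct.map grLin oddProj :
      A ⊗[ℂ] B →ₗ[ℂ] A ⊗[ℂ] B)

instance : Mul (AlgTensor A B) := ⟨fun x y => mulLin x y⟩

instance : Star (AlgTensor A B) := ⟨fun x => starLin x⟩

theorem mul_def (x y : AlgTensor A B) : x * y = mulLin x y := rfl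

theorem star_def (x : AlgTensor A B) : star x = starLin x := rfl

theorem tmul_mul_tmul (a a' : A) (b b' : B) :
    tmul a b * tmul a' b' = tmul (a * a') (evenProj b * b') + tmul (a * gr a') (oddProj b * b') :=
  rfl

theorem star_tmul (a : A) (b : B) :
    star (tmul a b) = tmul (star a) (star (evenProj b)) + tmul (star (gr a)) (star (oddProj b)) := by
  change starLin _ = _
  rfl

theorem tmul_mul_even (a a' : A) {b : B} (b' : B) (hb : IsEvenElem b) :
    tmul a b * tmul a' b' = tmul (a * a') (b * b') := by
  simp [tmul_mul_tmul, hb.evenProj, hb.oddProj]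

theorem tmul_mul_odd (a a' : A) {b : B} (b' : B) (hb : IsOddElem b) :
    tmul a b * tmul a' b' = tmul (a * gr a') (b * b') := by
  simp [tmul_mul_tmul, hb.evenProj, hb.oddProj]

theorem star_tmul_even (a : A) {b : B} (hb : IsEvenElem b) :
    star (tmul a b) = tmul (star a) (star b) := by
  simp [star_tmul, hb.evenProj, hb.oddProj]

theorem star_tmul_odd (a : A) {b : B} (hb : IsOddElem b) :
    star (tmul a b) = tmul (star (gr a)) (star b) := by
  simp [star_tmul, hb.evenProj, hb.oddProj]

protected theorem mul_add' (x y z : AlgTensor A B) : x * (y + z) = x * y + x * z :=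
  map_add (mulLin x) y z

protected theorem add_mul' (x y z : AlgTensor A B) : (x + y) * z = x * z + y * z :=
  LinearMap.map_add₂ mulLin x y z

protected theorem zero_mul' (x : AlgTensor A B) : 0 * x = 0 := LinearMap.map_zero₂ mulLin x

protected theorem mul_zero' (x : AlgTensor A B) : x * 0 = 0 := map_zero (mulLin x)

protected theorem star_add' (x y : AlgTensor A B) : star (x + y) = star x + star y :=
  map_add starLin x y

protected theorem star_zero' : star (0 : AlgTensor A B) = 0 := map_zero starLin

instance : NonUnitalRing (AlgTensor A B) where
  left_distrib := AlgTensor.mul_add'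
  right_distrib := AlgTensor.add_mul'
  zero_mul := AlgTensor.zero_mul'
  mul_zero := AlgTensor.mul_zero'
  mul_assoc x y z := by
    induction x using induction_hom with
    | zero => simp only [AlgTensor.zero_mul']
    | add x x' h h' => simp only [AlgTensor.add_mul', h, h']
    | even a b hb =>
      induction y using induction_hom with
      | zero => simp only [AlgTensor.zero_mul', AlgTensor.mul_zero']
      | add y y' h h' => simp only [AlgTensor.add_mul', AlgTensor.mul_add', h, h']
      | even a' b' hb' =>
        induction z using induction_on with
        | zero => simp only [AlgTensor.mul_zero']
        | add z z' h h' => simp only [AlgTensor.mul_add', h, h']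
        | tmul a'' b'' =>
          rw [tmul_mul_even _ _ _ hb, tmul_mul_even _ _ _ (hb.mul_even hb'),
            tmul_mul_even _ _ _ hb', tmul_mul_even _ _ _ hb, mul_assoc, mul_assoc]
      | odd a' b' hb' =>
        induction z using induction_on with
        | zero => simp only [AlgTensor.mul_zero']
        | add z z' h h' => simp only [AlgTensor.mul_add', h, h']
        | tmul a'' b'' =>
          rw [tmul_mul_even _ _ _ hb, tmul_mul_odd _ _ _ (hb.mul_odd hb'),
            tmul_mul_odd _ _ _ hb', tmul_mul_even _ _ _ hb, mul_assoc, mul_assoc]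
    | odd a b hb =>
      induction y using induction_hom with
      | zero => simp only [AlgTensor.zero_mul', AlgTensor.mul_zero']
      | add y y' h h' => simp only [AlgTensor.add_mul', AlgTensor.mul_add', h, h']
      | even a' b' hb' =>
        induction z using induction_on with
        | zero => simp only [AlgTensor.mul_zero']
        | add z z' h h' => simp only [AlgTensor.mul_add', h, h']
        | tmul a'' b'' =>
          rw [tmul_mul_odd _ _ _ hb, tmul_mul_odd _ _ _ (hb.mul_even hb'),
            tmul_mul_even _ _ _ hb', tmul_mul_odd _ _ _ hb, map_mul, mul_assoc, mul_assoc]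
      | odd a' b' hb' =>
        induction z using induction_on with
        | zero => simp only [AlgTensor.mul_zero']
        | add z z' h h' => simp only [AlgTensor.mul_add', h, h']
        | tmul a'' b'' =>
          rw [tmul_mul_odd _ _ _ hb, tmul_mul_even _ _ _ (hb.mul_odd hb'),
            tmul_mul_odd _ _ _ hb', tmul_mul_odd _ _ _ hb, map_mul, gr_gr, mul_assoc, mul_assoc]

instance : StarRing (AlgTensor A B) where
  star_add := AlgTensor.star_add'
  star_involutive x := by
    induction x using induction_hom with
    | zero => simp only [AlgTensor.star_zero']
    | add x x' h h' => simp only [AlgTensor.star_add', h, h']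
    | even a b hb => rw [star_tmul_even _ hb, star_tmul_even _ hb.star, star_star, star_star]
    | odd a b hb =>
      rw [star_tmul_odd _ hb, star_tmul_odd _ hb.star, map_star, gr_gr, star_star, star_star]
  star_mul x y := by
    induction x using induction_hom with
    | zero => simp only [AlgTensor.star_zero', zero_mul, mul_zero]
    | add x x' h h' => simp only [AlgTensor.star_add', add_mul, mul_add, h, h']
    | even a b hb =>
      induction y using induction_hom with
      | zero => simp only [AlgTensor.star_zero', zero_mul, mul_zero]
      | add y y' h h' => simp only [AlgTensor.star_add', add_mul, mul_add, h, h']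
      | even a' b' hb' =>
        rw [tmul_mul_even _ _ _ hb, star_tmul_even _ (hb.mul_even hb'), star_tmul_even _ hb,
          star_tmul_even _ hb', tmul_mul_even _ _ _ hb'.star, star_mul, star_mul]
      | odd a' b' hb' =>
        rw [tmul_mul_even _ _ _ hb, star_tmul_odd _ (hb.mul_odd hb'), star_tmul_even _ hb,
          star_tmul_odd _ hb', tmul_mul_odd _ _ _ hb'.star, map_mul, star_mul, star_mul, map_star]
    | odd a b hb =>
      induction y using induction_hom with
      | zero => simp only [AlgTensor.star_zero', zero_mul, mul_zero]
      | add y y' h h' => simp only [AlgTensor.star_add', add_mul, mul_add, h, h']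
      | even a' b' hb' =>
        rw [tmul_mul_odd _ _ _ hb, star_tmul_odd _ (hb.mul_even hb'), star_tmul_odd _ hb,
          star_tmul_even _ hb', tmul_mul_even _ _ _ hb'.star, map_mul, gr_gr, star_mul, star_mul]
      | odd a' b' hb' =>
        rw [tmul_mul_odd _ _ _ hb, star_tmul_even _ (hb.mul_odd hb'), star_tmul_odd _ hb,
          star_tmul_odd _ hb', tmul_mul_odd _ _ _ hb'.star, map_star, gr_gr, star_mul, star_mul]

instance : IsScalarTower ℂ (AlgTensor A B) (AlgTensor A B) :=
  ⟨fun c x y => LinearMap.map_smul₂ mulLin c x y⟩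

instance : SMulCommClass ℂ (AlgTensor A B) (AlgTensor A B) :=
  ⟨fun c x y => (map_smul (mulLin x) c y).symm⟩

instance : StarModule ℂ (AlgTensor A B) :=
  ⟨fun c x => LinearMap.map_smulₛₗ starLin c x⟩

end AlgTensor

/-! ## The maximal C*-norm and the graded maximal tensor product -/

variable (A B) in
/-- A graded-commuting pair of `*`-homomorphisms from `A` and `B` to a C*-algebra `D`:
`π_B(b) π_A(a) = (-1)^{|a||b|} π_A(a) π_B(b)` on homogeneous elements. -/
structure GradedCommutingPair (D : Type w) [NonUnitalCStarAlgebra D] where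
  left : A →⋆ₙₐ[ℂ] D
  right : B →⋆ₙₐ[ℂ] D
  comm_of_even : ∀ a b, IsEvenElem b → right b * left a = left a * right b
  comm_of_odd : ∀ a b, IsOddElem b → right b * left a = left (gr a) * right b

namespace GradedCommutingPair

variable {D : Type w} [NonUnitalCStarAlgebra D]

/-- The linear map `a ⊗ b ↦ π_A(a) π_B(b)`; it is the general form of a `*`-representation of
the algebraic graded tensor product. -/
def lift (π : GradedCommutingPair A B D) : AlgTensor A B →ₗ[ℂ] D :=
  TensorProduct.lift
    ((LinearMap.mul ℂ D).compl₁₂ (π.left : A →ₗ[ℂ] D) (π.right : B →ₗ[ℂ] D))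

theorem lift_tmul (π : GradedCommutingPair A B D) (a : A) (b : B) :
    π.lift (AlgTensor.tmul a b) = π.left a * π.right b := rfl

theorem lift_mul (π : GradedCommutingPair A B D) (x y : AlgTensor A B) :
    π.lift (x * y) = π.lift x * π.lift y := by
  induction y using AlgTensor.induction_on with
  | zero => simp
  | add y y' h h' => simp only [mul_add, map_add, h, h']
  | tmul a' b' =>
    induction x using AlgTensor.induction_hom with
    | zero => simp
    | add x x' h h' => simp only [add_mul, map_add, h, h']
    | even a b hb =>
      rw [AlgTensor.tmul_mul_even _ _ _ hb, lift_tmul, lift_tmul, lift_tmul, map_mul, map_mul,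
        mul_assoc, ← mul_assoc (π.left a'), ← π.comm_of_even _ _ hb, mul_assoc, mul_assoc]
    | odd a b hb =>
      rw [AlgTensor.tmul_mul_odd _ _ _ hb, lift_tmul, lift_tmul, lift_tmul, map_mul, map_mul,
        mul_assoc, ← mul_assoc (π.left (gr a')), ← π.comm_of_odd _ _ hb, mul_assoc, mul_assoc]

theorem lift_star (π : GradedCommutingPair A B D) (x : AlgTensor A B) :
    π.lift (star x) = star (π.lift x) := by
  induction x using AlgTensor.induction_hom with
  | zero => simp
  | add x x' h h' => simp only [star_add, map_add, h, h']
  | even a b hb =>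
    rw [AlgTensor.star_tmul_even _ hb, lift_tmul, lift_tmul, star_mul, ← map_star, ← map_star,
      π.comm_of_even _ _ hb.star]
  | odd a b hb =>
    rw [AlgTensor.star_tmul_odd _ hb, lift_tmul, lift_tmul, star_mul, ← map_star π.left,
      ← map_star π.right, π.comm_of_odd _ _ hb.star, map_star gr]

end GradedCommutingPair

namespace AlgTensor

/-- The norms of the images of `x` under all graded-commuting pairs of `*`-homomorphisms. -/
def normSet (x : AlgTensor A B) : Set ℝ :=
  {r | ∃ (D : Type (max u v)) (_ : NonUnitalCStarAlgebra D) (π : GradedCommutingPair A B D),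
    r = ‖π.lift x‖}

/-- The maximal C*-seminorm on the algebraic graded tensor product. -/
def maxNorm (x : AlgTensor A B) : ℝ := sSup (normSet x)

theorem bddAbove_normSet (x : AlgTensor A B) : BddAbove (normSet x) := by
  suffices h : ∃ C : ℝ, ∀ (D : Type (max u v)) (_ : NonUnitalCStarAlgebra D)
      (π : GradedCommutingPair A B D), ‖π.lift x‖ ≤ C by
    obtain ⟨C, hC⟩ := h
    exact ⟨C, by rintro _ ⟨D, iD, π, rfl⟩; exact hC D iD π⟩
  induction x using induction_on with
  | zero => exact ⟨0, fun D _ π => by simp⟩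
  | tmul a b =>
    refine ⟨‖a‖ * ‖b‖, fun D _ π => ?_⟩
    rw [GradedCommutingPair.lift_tmul]
    exact (norm_mul_le _ _).trans (mul_le_mul (NonUnitalStarAlgHom.norm_apply_le π.left a)
      (NonUnitalStarAlgHom.norm_apply_le π.right b) (norm_nonneg _) (norm_nonneg _))
  | add x y hx hy =>
    obtain ⟨C, hC⟩ := hx
    obtain ⟨C', hC'⟩ := hy
    refine ⟨C + C', fun D iD π => ?_⟩
    rw [map_add]
    exact (norm_add_le _ _).trans (add_le_add (hC D iD π) (hC' D iD π))

theorem norm_lift_le {D : Type (max u v)} [iD : NonUnitalCStarAlgebra D]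
    (π : GradedCommutingPair A B D) (x : AlgTensor A B) : ‖π.lift x‖ ≤ maxNorm x :=
  le_csSup (bddAbove_normSet x) ⟨D, iD, π, rfl⟩

theorem maxNorm_nonneg (x : AlgTensor A B) : 0 ≤ maxNorm x :=
  Real.sSup_nonneg (by rintro _ ⟨D, iD, π, rfl⟩; exact norm_nonneg _)

theorem maxNorm_le {x : AlgTensor A B} {C : ℝ} (hC : 0 ≤ C)
    (h : ∀ (D : Type (max u v)) [NonUnitalCStarAlgebra D] (π : GradedCommutingPair A B D),
      ‖π.lift x‖ ≤ C) : maxNorm x ≤ C :=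
  Real.sSup_le (by rintro _ ⟨D, iD, π, rfl⟩; exact h D π) hC

theorem maxNorm_smul_le (c : ℂ) (x : AlgTensor A B) : maxNorm (c • x) ≤ ‖c‖ * maxNorm x := by
  refine maxNorm_le (mul_nonneg (norm_nonneg _) (maxNorm_nonneg _)) fun D _ π => ?_
  rw [map_smul, norm_smul]
  exact mul_le_mul_of_nonneg_left (norm_lift_le π x) (norm_nonneg _)

theorem maxNorm_mul_le (x y : AlgTensor A B) : maxNorm (x * y) ≤ maxNorm x * maxNorm y := by
  refine maxNorm_le (mul_nonneg (maxNorm_nonneg _) (maxNorm_nonneg _)) fun D _ π => ?_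
  rw [π.lift_mul]
  exact (norm_mul_le _ _).trans (mul_le_mul (norm_lift_le π x) (norm_lift_le π y)
    (norm_nonneg _) (maxNorm_nonneg _))

theorem maxNorm_star_mul_self (x : AlgTensor A B) :
    maxNorm x * maxNorm x ≤ maxNorm (star x * x) := by
  have h : maxNorm x ≤ √(maxNorm (star x * x)) := by
    refine maxNorm_le (Real.sqrt_nonneg _) fun D _ π => Real.le_sqrt_of_sq_le ?_
    rw [sq, ← CStarRing.norm_star_mul_self, ← π.lift_star, ← π.lift_mul]
    exact norm_lift_le π _
  calc maxNorm x * maxNorm x ≤ √(maxNorm (star x * x)) * √(maxNorm (star x * x)) :=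
        mul_le_mul h h (maxNorm_nonneg _) (Real.sqrt_nonneg _)
    _ = _ := Real.mul_self_sqrt (maxNorm_nonneg _)

theorem maxNorm_star_le (x : AlgTensor A B) : maxNorm (star x) ≤ maxNorm x := by
  refine maxNorm_le (maxNorm_nonneg _) fun D _ π => ?_
  rw [π.lift_star, norm_star]
  exact norm_lift_le π x

variable (A B) in
/-- The maximal C*-seminorm, bundled. -/
def maxAddGroupSeminorm : AddGroupSeminorm (AlgTensor A B) where
  toFun := maxNorm
  map_zero' := le_antisymm (maxNorm_le le_rfl fun D _ π => by simp) (maxNorm_nonneg _)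
  add_le' x y := maxNorm_le (add_nonneg (maxNorm_nonneg _) (maxNorm_nonneg _)) fun D _ π => by
    rw [map_add]
    exact (norm_add_le _ _).trans (add_le_add (norm_lift_le π x) (norm_lift_le π y))
  neg' x := by
    have h : ∀ y : AlgTensor A B, maxNorm (-y) ≤ maxNorm y := fun y => by
      refine maxNorm_le (maxNorm_nonneg _) fun D _ π => ?_
      rw [map_neg, norm_neg]
      exact norm_lift_le π y
    exact le_antisymm (h x) (by simpa using h (-x))

instance : SeminormedAddCommGroup (AlgTensor A B) :=
  (maxAddGroupSeminorm A B).toSeminormedAddCommGroup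

theorem norm_def (x : AlgTensor A B) : ‖x‖ = maxNorm x := rfl

instance : NonUnitalSeminormedRing (AlgTensor A B) where
  __ := (inferInstance : SeminormedAddCommGroup (AlgTensor A B))
  __ := (inferInstance : NonUnitalRing (AlgTensor A B))
  norm_mul_le := maxNorm_mul_le

instance : NormedSpace ℂ (AlgTensor A B) where
  norm_smul_le := maxNorm_smul_le

instance : NormedStarGroup (AlgTensor A B) := ⟨maxNorm_star_le⟩

end AlgTensor

variable (A B) in
/-- The graded maximal tensor product of two graded C*-algebras: the Hausdorff completion of the
algebraic graded tensor product in the maximal C*-seminorm. -/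
def GTensor : Type (max u v) := Completion (AlgTensor A B)

namespace GTensor

instance : NormedAddCommGroup (GTensor A B) :=
  inferInstanceAs (NormedAddCommGroup (Completion (AlgTensor A B)))

instance : NormedSpace ℂ (GTensor A B) :=
  inferInstanceAs (NormedSpace ℂ (Completion (AlgTensor A B)))

instance : CompleteSpace (GTensor A B) :=
  inferInstanceAs (CompleteSpace (Completion (AlgTensor A B)))

/-- The canonical map from the algebraic tensor product to its completion. -/
def of : AlgTensor A B →L[ℂ] GTensor A B := Completion.toComplL

theorem norm_of (x : AlgTensor A B) : ‖of x‖ = ‖x‖ := Completion.norm_coe x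

theorem isDenseInducing_of : IsDenseInducing (of : AlgTensor A B → GTensor A B) :=
  Completion.isDenseInducing_coe

theorem denseRange_of : DenseRange (of : AlgTensor A B → GTensor A B) :=
  isDenseInducing_of.dense

/-- The elementary tensor `a ⊗ b`. -/
def tmul (a : A) (b : B) : GTensor A B := of (AlgTensor.tmul a b)

@[elab_as_elim]
theorem ind₁ {p : GTensor A B → Prop} (x : GTensor A B) (hp : IsClosed {x | p x})
    (h : ∀ x, p (of x)) : p x := Completion.induction_on x hp h

@[elab_as_elim]
theorem ind₂ {p : GTensor A B → GTensor A B → Prop} (x y : GTensor A B)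
    (hp : IsClosed {z : GTensor A B × GTensor A B | p z.1 z.2})
    (h : ∀ x y, p (of x) (of y)) : p x y := Completion.induction_on₂ x y hp h

@[elab_as_elim]
theorem ind₃ {p : GTensor A B → GTensor A B → GTensor A B → Prop} (x y z : GTensor A B)
    (hp : IsClosed {z : GTensor A B × GTensor A B × GTensor A B | p z.1 z.2.1 z.2.2})
    (h : ∀ x y z, p (of x) (of y) (of z)) : p x y z := Completion.induction_on₃ x y z hp h

/-- The product, extended by continuity. -/
instance : Mul (GTensor A B) :=
  ⟨fun x y => (isDenseInducing_of.prodMap isDenseInducing_of).extend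
    (fun p : AlgTensor A B × AlgTensor A B => of (p.1 * p.2)) (x, y)⟩

theorem of_mul (x y : AlgTensor A B) : of (x * y) = of x * of y :=
  ((isDenseInducing_of.prodMap isDenseInducing_of).extend_eq
    (f := fun p : AlgTensor A B × AlgTensor A B => of (p.1 * p.2))
    (of.continuous.comp continuous_mul) (x, y)).symm

instance : ContinuousMul (GTensor A B) where
  continuous_mul := by
    let o : AlgTensor A B →+ GTensor A B := (of : AlgTensor A B →L[ℂ] GTensor A B)
    let m := (AddMonoidHom.mul : AlgTensor A B →+ AlgTensor A B →+ AlgTensor A B).compr₂ o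
    have hm : Continuous fun p : AlgTensor A B × AlgTensor A B => m p.1 p.2 :=
      of.continuous.comp continuous_mul
    have di : IsDenseInducing o := isDenseInducing_of
    exact (di.extend_Z_bilin di hm :)

/-- The involution, extended by continuity. -/
instance : Star (GTensor A B) := ⟨Completion.map star⟩

theorem uniformContinuous_star_alg : UniformContinuous (star : AlgTensor A B → AlgTensor A B) :=
  (AddMonoidHomClass.isometry_of_norm (starAddEquiv : AlgTensor A B ≃+ AlgTensor A B)
    norm_star).uniformContinuous

theorem of_star (x : AlgTensor A B) : of (star x) = star (of x) :=
  (Completion.map_coe uniformContinuous_star_alg x).symm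

theorem continuous_star' : Continuous (star : GTensor A B → GTensor A B) :=
  Completion.continuous_map

instance : NonUnitalRing (GTensor A B) where
  zero_mul x := ind₁ x (isClosed_eq (by fun_prop) (by fun_prop)) fun x => by
    rw [← map_zero of, ← of_mul, zero_mul]
  mul_zero x := ind₁ x (isClosed_eq (by fun_prop) (by fun_prop)) fun x => by
    rw [← map_zero of, ← of_mul, mul_zero]
  mul_assoc x y z := ind₃ x y z (isClosed_eq (by fun_prop) (by fun_prop)) fun x y z => by
    simp only [← of_mul, mul_assoc]
  left_distrib x y z := ind₃ x y z (isClosed_eq (by fun_prop) (by fun_prop)) fun x y z => by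
    simp only [← of_mul, ← map_add, mul_add]
  right_distrib x y z := ind₃ x y z (isClosed_eq (by fun_prop) (by fun_prop)) fun x y z => by
    simp only [← of_mul, ← map_add, add_mul]

instance : NonUnitalNormedRing (GTensor A B) where
  __ := (inferInstance : NormedAddCommGroup (GTensor A B))
  __ := (inferInstance : NonUnitalRing (GTensor A B))
  norm_mul_le x y := ind₂ x y
    (isClosed_le (f := fun z : GTensor A B × GTensor A B => ‖z.1 * z.2‖)
      (g := fun z => ‖z.1‖ * ‖z.2‖) (by fun_prop) (by fun_prop)) fun x y => by
    simp only [← of_mul, norm_of]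
    exact norm_mul_le x y

instance : StarRing (GTensor A B) where
  star_involutive x := ind₁ x (isClosed_eq (continuous_star'.comp continuous_star') continuous_id)
    fun x => by simp only [← of_star, star_star]
  star_mul x y := ind₂ x y
    (isClosed_eq (f := fun z : GTensor A B × GTensor A B => star (z.1 * z.2))
      (g := fun z => star z.2 * star z.1) (continuous_star'.comp continuous_mul)
      ((continuous_star'.comp continuous_snd).mul (continuous_star'.comp continuous_fst)))
    fun x y => by simp only [← of_star, ← of_mul, star_mul]
  star_add x y := ind₂ x y
    (isClosed_eq (f := fun z : GTensor A B × GTensor A B => star (z.1 + z.2))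
      (g := fun z => star z.1 + star z.2) (continuous_star'.comp continuous_add)
      ((continuous_star'.comp continuous_fst).add (continuous_star'.comp continuous_snd)))
    fun x y => by simp only [← of_star, ← map_add, star_add]

instance : CStarRing (GTensor A B) where
  norm_mul_self_le x := ind₁ x
    (isClosed_le (f := fun z : GTensor A B => ‖z‖ * ‖z‖) (g := fun z => ‖star z * z‖)
      (by fun_prop) ((continuous_star'.mul continuous_id).norm)) fun x => by
      simp only [← of_star, ← of_mul, norm_of]
      exact AlgTensor.maxNorm_star_mul_self x

instance : IsScalarTower ℂ (GTensor A B) (GTensor A B) where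
  smul_assoc c x y := ind₂ x y
    (isClosed_eq (f := fun z : GTensor A B × GTensor A B => (c • z.1) • z.2)
      (g := fun z => c • (z.1 • z.2)) ((continuous_fst.const_smul c).mul continuous_snd)
      ((continuous_fst.mul continuous_snd).const_smul c)) fun x y => by
    simp only [smul_eq_mul, ← of_mul, ← map_smul, smul_mul_assoc]

instance : SMulCommClass ℂ (GTensor A B) (GTensor A B) where
  smul_comm c x y := ind₂ x y
    (isClosed_eq (f := fun z : GTensor A B × GTensor A B => c • (z.1 • z.2))
      (g := fun z => z.1 • (c • z.2)) ((continuous_fst.mul continuous_snd).const_smul c)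
      (continuous_fst.mul (continuous_snd.const_smul c))) fun x y => by
    simp only [smul_eq_mul, ← of_mul, ← map_smul, mul_smul_comm]

instance : StarModule ℂ (GTensor A B) where
  star_smul c x := ind₁ x
    (isClosed_eq (f := fun z : GTensor A B => star (c • z)) (g := fun z => star c • star z)
      (continuous_star'.comp (continuous_const_smul c))
      ((continuous_const_smul (star c)).comp continuous_star')) fun x => by
    simp only [← of_star, ← map_smul, star_smul]

/-- The graded maximal tensor product is a C*-algebra. -/
instance : NonUnitalCStarAlgebra (GTensor A B) where

end GTensor

end Algebra

/-! ## Graded `*`-homomorphisms and the point-norm topology -/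

section Hom

/-- Graded `*`-homomorphisms. -/
structure GradedHom (A : Type u) (B : Type v)
    [NonUnitalCStarAlgebra A] [GradedCStarAlgebra A]
    [NonUnitalCStarAlgebra B] [GradedCStarAlgebra B] extends A →⋆ₙₐ[ℂ] B where
  map_gr' : ∀ a, toFun (gr a) = gr (toFun a)

variable {A A' : Type u} {B B' : Type v} {C : Type w}
  [NonUnitalCStarAlgebra A] [GradedCStarAlgebra A]
  [NonUnitalCStarAlgebra A'] [GradedCStarAlgebra A']
  [NonUnitalCStarAlgebra B] [GradedCStarAlgebra B]
  [NonUnitalCStarAlgebra B'] [GradedCStarAlgebra B']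
  [NonUnitalCStarAlgebra C] [GradedCStarAlgebra C]

namespace GradedHom

instance : FunLike (GradedHom A B) A B where
  coe φ := φ.toFun
  coe_injective φ ψ h := by
    obtain ⟨φ, hφ⟩ := φ
    obtain ⟨ψ, hψ⟩ := ψ
    have : φ = ψ := DFunLike.coe_injective h
    subst this
    rfl

theorem coe_toHom (φ : GradedHom A B) (a : A) : φ.toNonUnitalStarAlgHom a = φ a := rfl

@[ext] theorem ext {φ ψ : GradedHom A B} (h : ∀ a, φ a = ψ a) : φ = ψ := DFunLike.ext _ _ h

theorem map_gr (φ : GradedHom A B) (a : A) : φ (gr a) = gr (φ a) := φ.map_gr' a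

/-- The zero homomorphism, the base point of the space of graded `*`-homomorphisms. -/
instance : Zero (GradedHom A B) :=
  ⟨{ toNonUnitalStarAlgHom := 0, map_gr' := fun _ => (map_zero (gr : B →⋆ₙₐ[ℂ] B)).symm }⟩

@[simp] theorem zero_apply (a : A) : (0 : GradedHom A B) a = 0 := rfl

/-- Composition of graded `*`-homomorphisms. -/
def comp (ψ : GradedHom B C) (φ : GradedHom A B) : GradedHom A C where
  toNonUnitalStarAlgHom := ψ.toNonUnitalStarAlgHom.comp φ.toNonUnitalStarAlgHom
  map_gr' a := by
    change ψ (φ (gr a)) = gr (ψ (φ a))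
    rw [map_gr, map_gr]

@[simp] theorem comp_apply (ψ : GradedHom B C) (φ : GradedHom A B) (a : A) :
    ψ.comp φ a = ψ (φ a) := rfl

variable (A) in
/-- The identity. -/
def id : GradedHom A A where
  toNonUnitalStarAlgHom := NonUnitalStarAlgHom.id ℂ A
  map_gr' _ := rfl

@[simp] theorem id_apply (a : A) : GradedHom.id A a = a := rfl

variable (A) in
/-- The grading automorphism as a graded `*`-homomorphism. -/
def grading : GradedHom A A where
  toNonUnitalStarAlgHom := gr
  map_gr' _ := rfl

/-- The point-norm topology: the topology of pointwise convergence in norm. -/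
instance : TopologicalSpace (GradedHom A B) :=
  TopologicalSpace.induced (fun φ : GradedHom A B => (φ : A → B)) Pi.topologicalSpace

theorem continuous_iff {X : Type*} [TopologicalSpace X] {f : X → GradedHom A B} :
    Continuous f ↔ ∀ a, Continuous fun x => f x a := by
  rw [continuous_induced_rng, continuous_pi_iff]
  rfl

theorem continuous_eval (a : A) : Continuous fun φ : GradedHom A B => φ a :=
  continuous_iff.1 continuous_id a

end GradedHom

/-! ## Functoriality of the graded maximal tensor product -/

/-- Restriction of a graded-commuting pair along graded `*`-homomorphisms. -/
def GradedCommutingPair.restrict {D : Type*} [NonUnitalCStarAlgebra D]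
    (π : GradedCommutingPair A' B' D) (φ : GradedHom A A') (ψ : GradedHom B B') :
    GradedCommutingPair A B D where
  left := π.left.comp φ.toNonUnitalStarAlgHom
  right := π.right.comp ψ.toNonUnitalStarAlgHom
  comm_of_even a b hb := π.comm_of_even (φ a) (ψ b) (by rw [IsEvenElem, ← ψ.map_gr, hb])
  comm_of_odd a b hb := by
    change π.right (ψ b) * π.left (φ a) = π.left (φ (gr a)) * π.right (ψ b)
    rw [φ.map_gr]
    refine π.comm_of_odd (φ a) (ψ b) ?_
    rw [IsOddElem, ← ψ.map_gr, hb]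
    exact map_neg ψ.toNonUnitalStarAlgHom b

namespace AlgTensor

/-- The map `a ⊗ b ↦ φ(a) ⊗ ψ(b)`. -/
def map (φ : GradedHom A A') (ψ : GradedHom B B') : AlgTensor A B →ₗ[ℂ] AlgTensor A' B' :=
  TensorProduct.map (φ.toNonUnitalStarAlgHom : A →ₗ[ℂ] A')
    (ψ.toNonUnitalStarAlgHom : B →ₗ[ℂ] B')

@[simp] theorem map_tmul (φ : GradedHom A A') (ψ : GradedHom B B') (a : A) (b : B) :
    map φ ψ (tmul a b) = tmul (φ a) (ψ b) := rfl

theorem _root_.SpectralK.GradedHom.isEvenElem (ψ : GradedHom B B') {b : B} (hb : IsEvenElem b) :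
    IsEvenElem (ψ b) := by rw [IsEvenElem, ← ψ.map_gr, hb]

theorem _root_.SpectralK.GradedHom.isOddElem (ψ : GradedHom B B') {b : B} (hb : IsOddElem b) :
    IsOddElem (ψ b) := by
  rw [IsOddElem, ← ψ.map_gr, hb]
  exact map_neg ψ.toNonUnitalStarAlgHom b

theorem map_mul' (φ : GradedHom A A') (ψ : GradedHom B B') (x y : AlgTensor A B) :
    map φ ψ (x * y) = map φ ψ x * map φ ψ y := by
  have hφ : ∀ a b, φ (a * b) = φ a * φ b := map_mul φ.toNonUnitalStarAlgHom
  have hψ : ∀ a b, ψ (a * b) = ψ a * ψ b := map_mul ψ.toNonUnitalStarAlgHom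
  induction y using induction_on with
  | zero => simp
  | add y y' h h' => simp only [mul_add, map_add, h, h']
  | tmul a' b' =>
    induction x using induction_hom with
    | zero => simp
    | add x x' h h' => simp only [add_mul, map_add, h, h']
    | even a b hb =>
      rw [tmul_mul_even _ _ _ hb, map_tmul, map_tmul, map_tmul,
        tmul_mul_even _ _ _ (ψ.isEvenElem hb), hφ, hψ]
    | odd a b hb =>
      rw [tmul_mul_odd _ _ _ hb, map_tmul, map_tmul, map_tmul,
        tmul_mul_odd _ _ _ (ψ.isOddElem hb), hφ, hψ, φ.map_gr]

theorem map_star' (φ : GradedHom A A') (ψ : GradedHom B B') (x : AlgTensor A B) :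
    map φ ψ (star x) = star (map φ ψ x) := by
  have hφ : ∀ a, φ (star a) = star (φ a) := map_star φ.toNonUnitalStarAlgHom
  have hψ : ∀ a, ψ (star a) = star (ψ a) := map_star ψ.toNonUnitalStarAlgHom
  induction x using induction_hom with
  | zero => simp
  | add x x' h h' => simp only [star_add, map_add, h, h']
  | even a b hb =>
    rw [star_tmul_even _ hb, map_tmul, map_tmul, star_tmul_even _ (ψ.isEvenElem hb), hφ, hψ]
  | odd a b hb =>
    rw [star_tmul_odd _ hb, map_tmul, map_tmul, star_tmul_odd _ (ψ.isOddElem hb), hφ, hψ, φ.map_gr]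

theorem lift_map {D : Type*} [NonUnitalCStarAlgebra D] (π : GradedCommutingPair A' B' D)
    (φ : GradedHom A A') (ψ : GradedHom B B') (x : AlgTensor A B) :
    π.lift (map φ ψ x) = (π.restrict φ ψ).lift x := by
  induction x using induction_on with
  | zero => simp
  | add x x' h h' => simp only [map_add, h, h']
  | tmul a b => rfl

theorem norm_map_le (φ : GradedHom A A') (ψ : GradedHom B B') (x : AlgTensor A B) :
    ‖map φ ψ x‖ ≤ ‖x‖ :=
  maxNorm_le (maxNorm_nonneg _) fun D _ π => by
    rw [lift_map]
    exact norm_lift_le _ x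

theorem uniformContinuous_map (φ : GradedHom A A') (ψ : GradedHom B B') :
    UniformContinuous (map φ ψ) :=
  (AddMonoidHomClass.lipschitz_of_bound (map φ ψ) 1
    (by simpa using norm_map_le φ ψ)).uniformContinuous

end AlgTensor

namespace GTensor

/-- The map `φ ⊗ ψ`, extended by continuity. -/
def mapFun (φ : GradedHom A A') (ψ : GradedHom B B') : GTensor A B → GTensor A' B' :=
  Completion.map (AlgTensor.map φ ψ)

theorem mapFun_of (φ : GradedHom A A') (ψ : GradedHom B B') (x : AlgTensor A B) :
    mapFun φ ψ (of x) = of (AlgTensor.map φ ψ x) :=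
  Completion.map_coe (AlgTensor.uniformContinuous_map φ ψ) x

theorem continuous_mapFun (φ : GradedHom A A') (ψ : GradedHom B B') : Continuous (mapFun φ ψ) :=
  Completion.continuous_map (f := AlgTensor.map φ ψ)

/-- The `*`-homomorphism `φ ⊗ ψ`. -/
def mapHom (φ : GradedHom A A') (ψ : GradedHom B B') : GTensor A B →⋆ₙₐ[ℂ] GTensor A' B' :=
  have hc := continuous_mapFun φ ψ
  { toFun := mapFun φ ψ
    map_smul' := fun c x => ind₁ x
      (isClosed_eq (hc.comp (continuous_const_smul c)) ((continuous_const_smul c).comp hc))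
      fun x => by
        change mapFun φ ψ (c • of x) = c • mapFun φ ψ (of x)
        rw [← map_smul, mapFun_of, mapFun_of, map_smul, map_smul]
    map_zero' := by
      have := mapFun_of φ ψ 0
      rwa [map_zero, map_zero, map_zero] at this
    map_add' := fun x y => ind₂ x y
      (isClosed_eq (f := fun z : GTensor A B × GTensor A B => mapFun φ ψ (z.1 + z.2))
        (g := fun z => mapFun φ ψ z.1 + mapFun φ ψ z.2)
        (hc.comp continuous_add) ((hc.comp continuous_fst).add (hc.comp continuous_snd)))
      fun x y => by rw [← map_add, mapFun_of, map_add, map_add, mapFun_of, mapFun_of]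
    map_mul' := fun x y => ind₂ x y
      (isClosed_eq (f := fun z : GTensor A B × GTensor A B => mapFun φ ψ (z.1 * z.2))
        (g := fun z => mapFun φ ψ z.1 * mapFun φ ψ z.2)
        (hc.comp continuous_mul) ((hc.comp continuous_fst).mul (hc.comp continuous_snd)))
      fun x y => by
        rw [← of_mul, mapFun_of, AlgTensor.map_mul', of_mul, mapFun_of, mapFun_of]
    map_star' := fun x => ind₁ x
      (isClosed_eq (hc.comp continuous_star') (continuous_star'.comp hc))
      fun x => by
        change mapFun φ ψ (star (of x)) = star (mapFun φ ψ (of x))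
        rw [← of_star, mapFun_of, AlgTensor.map_star', of_star, mapFun_of] }

theorem mapHom_of (φ : GradedHom A A') (ψ : GradedHom B B') (x : AlgTensor A B) :
    mapHom φ ψ (of x) = of (AlgTensor.map φ ψ x) := mapFun_of φ ψ x

theorem continuous_mapHom (φ : GradedHom A A') (ψ : GradedHom B B') :
    Continuous (mapHom φ ψ) := continuous_mapFun φ ψ

/-- The grading `ε ⊗ ε`. -/
instance : GradedCStarAlgebra (GTensor A B) where
  grading := mapHom (GradedHom.grading A) (GradedHom.grading B)
  grading_grading x := ind₁ x
    (isClosed_eq ((continuous_mapHom _ _).comp (continuous_mapHom _ _)) continuous_id) fun x => by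
      rw [mapHom_of, mapHom_of]
      congr 1
      induction x using AlgTensor.induction_on with
      | zero => simp
      | add x x' h h' => simp only [map_add, h, h']
      | tmul a b =>
        rw [AlgTensor.map_tmul, AlgTensor.map_tmul]
        exact congrArg₂ AlgTensor.tmul (gr_gr a) (gr_gr b)

theorem gr_def (x : GTensor A B) :
    gr x = mapHom (GradedHom.grading A) (GradedHom.grading B) x := rfl

/-- The graded `*`-homomorphism `φ ⊗ ψ`. -/
def map (φ : GradedHom A A') (ψ : GradedHom B B') : GradedHom (GTensor A B) (GTensor A' B') where
  toNonUnitalStarAlgHom := mapHom φ ψ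
  map_gr' x := by
    change mapHom φ ψ (gr x) = gr (mapHom φ ψ x)
    simp only [gr_def]
    refine ind₁ x (isClosed_eq ((continuous_mapHom _ _).comp (continuous_mapHom _ _))
      ((continuous_mapHom _ _).comp (continuous_mapHom _ _))) fun x => ?_
    rw [mapHom_of, mapHom_of, mapHom_of, mapHom_of]
    congr 1
    induction x using AlgTensor.induction_on with
    | zero => simp
    | add x x' h h' => simp only [map_add, h, h']
    | tmul a b =>
      simp only [AlgTensor.map_tmul]
      exact congrArg₂ AlgTensor.tmul (φ.map_gr a) (ψ.map_gr b)

theorem map_of (φ : GradedHom A A') (ψ : GradedHom B B') (x : AlgTensor A B) :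
    map φ ψ (of x) = of (AlgTensor.map φ ψ x) := mapHom_of φ ψ x

theorem continuous_map (φ : GradedHom A A') (ψ : GradedHom B B') : Continuous (map φ ψ) :=
  continuous_mapHom φ ψ

end GTensor

/-! ## The Real structure on the graded maximal tensor product -/

section Real

variable [RealCStarAlgebra A] [RealCStarAlgebra B] [RealCStarAlgebra A'] [RealCStarAlgebra B']

/-- The Real structure `a ↦ ā`. -/
abbrev cj : A →ₗ⋆[ℂ] A := RealCStarAlgebra.conj

/-- The `*`-homomorphism `a ↦ (π(ā)*)ᵒᵖ` into the opposite algebra. -/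
def opConj {D : Type*} [NonUnitalCStarAlgebra D] (π : A →⋆ₙₐ[ℂ] D) : A →⋆ₙₐ[ℂ] Dᵐᵒᵖ where
  toFun a := MulOpposite.op (star (π (cj a)))
  map_smul' c a := by
    rw [LinearMap.map_smulₛₗ, map_smul, star_smul]
    simp
  map_zero' := by simp
  map_add' a b := by simp
  map_mul' a b := by
    rw [RealCStarAlgebra.conj_mul, map_mul, star_mul, MulOpposite.op_mul]
  map_star' a := by
    rw [RealCStarAlgebra.conj_star, map_star, MulOpposite.op_star]

/-- The conjugate of a graded-commuting pair. -/
def GradedCommutingPair.conj {D : Type*} [NonUnitalCStarAlgebra D]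
    (π : GradedCommutingPair A B D) : GradedCommutingPair A B Dᵐᵒᵖ where
  left := opConj π.left
  right := opConj π.right
  comm_of_even a b hb := by
    have h : IsEvenElem (cj b) := by rw [IsEvenElem, ← RealCStarAlgebra.conj_grading, hb]
    change MulOpposite.op _ * MulOpposite.op _ = MulOpposite.op _ * MulOpposite.op _
    rw [← MulOpposite.op_mul, ← MulOpposite.op_mul, ← star_mul, ← star_mul,
      π.comm_of_even _ _ h]
  comm_of_odd a b hb := by
    have h : IsOddElem (cj b) := by
      rw [IsOddElem, ← RealCStarAlgebra.conj_grading, hb, map_neg]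
    change MulOpposite.op _ * MulOpposite.op _ = MulOpposite.op _ * MulOpposite.op _
    rw [← MulOpposite.op_mul, ← MulOpposite.op_mul, ← star_mul, ← star_mul,
      RealCStarAlgebra.conj_grading, π.comm_of_odd _ _ h]

namespace AlgTensor

variable (A B) in
/-- The conjugate-linear map `a ⊗ b ↦ ā ⊗ b̄`. -/
def conj : AlgTensor A B →ₗ⋆[ℂ] AlgTensor A B :=
  TensorProduct.map (cj : A →ₗ⋆[ℂ] A) (cj : B →ₗ⋆[ℂ] B)

@[simp] theorem conj_tmul (a : A) (b : B) : conj A B (tmul a b) = tmul (cj a) (cj b) := rfl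

theorem lift_conj {D : Type*} [NonUnitalCStarAlgebra D] (π : GradedCommutingPair A B D)
    (x : AlgTensor A B) : π.conj.lift x = MulOpposite.op (star (π.lift (conj A B x))) := by
  induction x using induction_on with
  | zero => simp
  | add x x' h h' => simp only [map_add, h, h', star_add, MulOpposite.op_add]
  | tmul a b =>
    change MulOpposite.op (star (π.left (cj a))) * MulOpposite.op (star (π.right (cj b))) = _
    rw [conj_tmul, GradedCommutingPair.lift_tmul, star_mul, MulOpposite.op_mul]

theorem norm_conj_le (x : AlgTensor A B) : ‖conj A B x‖ ≤ ‖x‖ :=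
  maxNorm_le (maxNorm_nonneg _) fun D _ π => by
    have h := norm_lift_le π.conj x
    rwa [lift_conj, MulOpposite.norm_op, norm_star] at h

theorem uniformContinuous_conj : UniformContinuous (conj A B) :=
  (AddMonoidHomClass.lipschitz_of_bound (conj A B) 1
    (by simpa using norm_conj_le)).uniformContinuous

theorem isEvenElem_cj {b : B} (hb : IsEvenElem b) : IsEvenElem (cj b) := by
  rw [IsEvenElem, ← RealCStarAlgebra.conj_grading, hb]

theorem isOddElem_cj {b : B} (hb : IsOddElem b) : IsOddElem (cj b) := by
  rw [IsOddElem, ← RealCStarAlgebra.conj_grading, hb, map_neg]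

theorem conj_mul' (x y : AlgTensor A B) : conj A B (x * y) = conj A B x * conj A B y := by
  induction y using induction_on with
  | zero => simp
  | add y y' h h' => simp only [mul_add, map_add, h, h']
  | tmul a' b' =>
    induction x using induction_hom with
    | zero => simp
    | add x x' h h' => simp only [add_mul, map_add, h, h']
    | even a b hb =>
      rw [tmul_mul_even _ _ _ hb, conj_tmul, conj_tmul, conj_tmul,
        tmul_mul_even _ _ _ (isEvenElem_cj hb), RealCStarAlgebra.conj_mul,
        RealCStarAlgebra.conj_mul]
    | odd a b hb =>
      rw [tmul_mul_odd _ _ _ hb, conj_tmul, conj_tmul, conj_tmul,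
        tmul_mul_odd _ _ _ (isOddElem_cj hb), RealCStarAlgebra.conj_mul,
        RealCStarAlgebra.conj_mul, RealCStarAlgebra.conj_grading]

theorem conj_star' (x : AlgTensor A B) : conj A B (star x) = star (conj A B x) := by
  induction x using induction_hom with
  | zero => simp
  | add x x' h h' => simp only [star_add, map_add, h, h']
  | even a b hb =>
    rw [star_tmul_even _ hb, conj_tmul, conj_tmul, star_tmul_even _ (isEvenElem_cj hb),
      RealCStarAlgebra.conj_star, RealCStarAlgebra.conj_star]
  | odd a b hb =>
    rw [star_tmul_odd _ hb, conj_tmul, conj_tmul, star_tmul_odd _ (isOddElem_cj hb),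
      RealCStarAlgebra.conj_star, RealCStarAlgebra.conj_star, RealCStarAlgebra.conj_grading]

end AlgTensor

namespace GTensor

variable (A B) in
/-- The map `a ⊗ b ↦ ā ⊗ b̄`, extended by continuity. -/
def conjFun : GTensor A B → GTensor A B := Completion.map (AlgTensor.conj A B)

theorem conjFun_of (x : AlgTensor A B) : conjFun A B (of x) = of (AlgTensor.conj A B x) :=
  Completion.map_coe AlgTensor.uniformContinuous_conj x

theorem continuous_conjFun : Continuous (conjFun A B) :=
  Completion.continuous_map (f := AlgTensor.conj A B)

variable (A B) in
/-- The conjugate-linear map `a ⊗ b ↦ ā ⊗ b̄` on the completed tensor product. -/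
def conj : GTensor A B →ₗ⋆[ℂ] GTensor A B :=
  have hc : Continuous (conjFun A B) := continuous_conjFun
  { toFun := conjFun A B
    map_smul' := fun c x => ind₁ x
      (isClosed_eq (hc.comp (continuous_const_smul c)) ((continuous_const_smul (star c)).comp hc))
      fun x => by
        change conjFun A B (c • of x) = star c • conjFun A B (of x)
        rw [← map_smul, conjFun_of, conjFun_of, LinearMap.map_smulₛₗ, map_smul]
        rfl
    map_add' := fun x y => ind₂ x y
      (isClosed_eq (f := fun z : GTensor A B × GTensor A B => conjFun A B (z.1 + z.2))
        (g := fun z => conjFun A B z.1 + conjFun A B z.2)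
        (hc.comp continuous_add) ((hc.comp continuous_fst).add (hc.comp continuous_snd)))
      fun x y => by rw [← map_add, conjFun_of, map_add, map_add, conjFun_of, conjFun_of] }

theorem conj_of (x : AlgTensor A B) : conj A B (of x) = of (AlgTensor.conj A B x) := conjFun_of x

theorem continuous_conj : Continuous (conj A B) := continuous_conjFun

/-- The Real structure `τ ⊗ τ`. -/
instance : RealCStarAlgebra (GTensor A B) where
  conj := conj A B
  conj_mul x y := ind₂ x y
    (isClosed_eq (f := fun z : GTensor A B × GTensor A B => conj A B (z.1 * z.2))
      (g := fun z => conj A B z.1 * conj A B z.2) (continuous_conj.comp continuous_mul)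
      ((continuous_conj.comp continuous_fst).mul (continuous_conj.comp continuous_snd)))
    fun x y => by simp only [← of_mul, conj_of, AlgTensor.conj_mul']
  conj_star x := ind₁ x
    (isClosed_eq (continuous_conj.comp continuous_star') (continuous_star'.comp continuous_conj))
    fun x => by simp only [← of_star, conj_of, AlgTensor.conj_star']
  conj_conj x := ind₁ x (isClosed_eq (continuous_conj.comp continuous_conj) continuous_id)
    fun x => by
      rw [conj_of, conj_of]
      congr 1
      induction x using AlgTensor.induction_on with
      | zero => simp
      | add x x' h h' => simp only [map_add, h, h']
      | tmul a b =>
        simp only [AlgTensor.conj_tmul]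
        rw [RealCStarAlgebra.conj_conj, RealCStarAlgebra.conj_conj]
  conj_grading x := by
    change conj A B (gr x) = gr (conj A B x)
    simp only [gr_def]
    refine ind₁ x (isClosed_eq (continuous_conj.comp (continuous_mapHom _ _))
      ((continuous_mapHom _ _).comp continuous_conj)) fun x => ?_
    rw [mapHom_of, conj_of, conj_of, mapHom_of]
    congr 1
    induction x using AlgTensor.induction_on with
    | zero => simp
    | add x x' h h' => simp only [map_add, h, h']
    | tmul a b =>
      simp only [AlgTensor.map_tmul, AlgTensor.conj_tmul]
      exact congrArg₂ AlgTensor.tmul (RealCStarAlgebra.conj_grading a)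
        (RealCStarAlgebra.conj_grading b)

theorem cj_def (x : GTensor A B) : cj x = conj A B x := rfl

theorem map_cj (φ : GradedHom A A') (ψ : GradedHom B B') (hφ : ∀ a, φ (cj a) = cj (φ a))
    (hψ : ∀ b, ψ (cj b) = cj (ψ b)) (x : GTensor A B) : map φ ψ (cj x) = cj (map φ ψ x) := by
  simp only [cj_def]
  refine ind₁ x (isClosed_eq ((continuous_map _ _).comp continuous_conj)
    (continuous_conj.comp (continuous_map _ _))) fun x => ?_
  rw [conj_of, map_of, map_of, conj_of]
  congr 1
  induction x using AlgTensor.induction_on with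
  | zero => simp
  | add x x' h h' => simp only [map_add, h, h']
  | tmul a b => simp only [AlgTensor.map_tmul, AlgTensor.conj_tmul, hφ, hψ]

end GTensor

/-- Graded Real `*`-homomorphisms, with the (subspace topology of the) point-norm topology. -/
def RealGradedHom (A : Type u) (B : Type v)
    [NonUnitalCStarAlgebra A] [GradedCStarAlgebra A] [RealCStarAlgebra A]
    [NonUnitalCStarAlgebra B] [GradedCStarAlgebra B] [RealCStarAlgebra B] : Type (max u v) :=
  {φ : GradedHom A B // ∀ a, φ (cj a) = cj (φ a)}

instance : TopologicalSpace (RealGradedHom A B) :=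
  inferInstanceAs (TopologicalSpace {φ : GradedHom A B // ∀ a, φ (cj a) = cj (φ a)})

instance : Zero (RealGradedHom A B) := ⟨⟨0, fun _ => (map_zero cj).symm⟩⟩

end Real

end Hom

/-! ## The graded Real C*-algebra `C₀(ℝ)` -/

/-- The C*-algebra `C₀(ℝ)`. -/
abbrev S : Type := C₀(ℝ, ℂ)

/-- The reflection `f(x) ↦ f(-x)`. -/
def reflect (f : S) : S := f.comp (Homeomorph.neg ℝ).toCocompactMap

theorem reflect_apply (f : S) (x : ℝ) : reflect f x = f (-x) := rfl

/-- The even-odd grading of `C₀(ℝ)`. -/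
instance : GradedCStarAlgebra S where
  grading :=
    { toFun := reflect
      map_smul' := fun _ _ => rfl
      map_zero' := rfl
      map_add' := fun _ _ => rfl
      map_mul' := fun _ _ => rfl
      map_star' := fun _ => rfl }
  grading_grading f := by
    ext x
    change f (- -x) = f x
    rw [neg_neg]

/-- The Real structure of `C₀(ℝ)`: pointwise complex conjugation. -/
instance : RealCStarAlgebra S where
  conj := (starLinearEquiv ℂ : S ≃ₗ⋆[ℂ] S).toLinearMap
  conj_mul f g := by
    ext x
    exact map_mul (starRingEnd ℂ) (f x) (g x)
  conj_star _ := rfl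
  conj_conj f := star_star f
  conj_grading _ := rfl

/-! ## Graded and Real Hilbert spaces -/

section Hilbert

/-- A `ℤ/2`-graded Hilbert space `H = H₀ ⊕ H₁` (orthogonal sum), given by the isometric involution
which is `1` on the even part `H₀` and `-1` on the odd part `H₁`. -/
class GradedHilbertSpace (H : Type v) [NormedAddCommGroup H] [InnerProductSpace ℂ H] where
  /-- the grading operator -/
  parity : H →ₗᵢ[ℂ] H
  parity_parity : ∀ x, parity (parity x) = x

/-- A Real structure on a graded Hilbert space: a conjugate-linear involution `x ↦ x̄` with
`⟨x̄, ȳ⟩` the complex conjugate of `⟨x, y⟩`, compatible with the grading. -/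
class RealHilbertSpace (H : Type v) [NormedAddCommGroup H] [InnerProductSpace ℂ H]
    [GradedHilbertSpace H] where
  /-- the Real structure `x ↦ x̄` -/
  conj : H →ₗ⋆[ℂ] H
  conj_conj : ∀ x, conj (conj x) = x
  inner_conj : ∀ x y, inner ℂ (conj x) (conj y) = star (inner ℂ x y)
  conj_parity : ∀ x, conj (GradedHilbertSpace.parity x) = GradedHilbertSpace.parity (conj x)

variable {H K : Type v} [NormedAddCommGroup H] [InnerProductSpace ℂ H] [CompleteSpace H]
  [GradedHilbertSpace H]
  [NormedAddCommGroup K] [InnerProductSpace ℂ K] [CompleteSpace K] [GradedHilbertSpace K]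

/-- The grading operator of a graded Hilbert space. -/
abbrev parity : H →ₗᵢ[ℂ] H := GradedHilbertSpace.parity

@[simp] theorem parity_parity (x : H) : parity (parity x) = x :=
  GradedHilbertSpace.parity_parity x

variable (H) in
/-- The even part of a graded Hilbert space. -/
def evenPart : Submodule ℂ H := LinearMap.eqLocus parity.toLinearMap LinearMap.id

variable (H) in
/-- The odd part of a graded Hilbert space. -/
def oddPart : Submodule ℂ H := LinearMap.eqLocus parity.toLinearMap (-LinearMap.id)

/-- A Real structure on a Hilbert space is isometric. -/
theorem norm_hconj [RealHilbertSpace H] (x : H) : ‖RealHilbertSpace.conj x‖ = ‖x‖ := by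
  have h := RealHilbertSpace.inner_conj x x
  rw [inner_self_eq_norm_sq_to_K, inner_self_eq_norm_sq_to_K] at h
  have h' : ‖(RealHilbertSpace.conj x : H)‖ ^ 2 = ‖x‖ ^ 2 := by
    have h2 := congrArg Complex.re h
    simpa [← Complex.ofReal_pow] using h2
  exact (sq_eq_sq₀ (norm_nonneg _) (norm_nonneg _)).1 h'

/-- The Real structure of a Hilbert space as a continuous conjugate-linear map. -/
def hconj [RealHilbertSpace H] : H →L⋆[ℂ] H :=
  RealHilbertSpace.conj.mkContinuous 1 fun x => by rw [norm_hconj, one_mul]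

theorem hconj_apply [RealHilbertSpace H] (x : H) : hconj x = RealHilbertSpace.conj x := rfl

@[simp] theorem hconj_hconj [RealHilbertSpace H] (x : H) : hconj (hconj x) = x :=
  RealHilbertSpace.conj_conj x

/-! ### Direct sums -/

/-- The grading of `H ⊕ K`. -/
instance : GradedHilbertSpace (WithLp 2 (H × K)) where
  parity := parity.withLpProdMap 2 parity
  parity_parity x := by
    apply (WithLp.equiv 2 (H × K)).injective
    exact Prod.ext (parity_parity _) (parity_parity _)

/-- The Real structure of `H ⊕ K`. -/
instance [RealHilbertSpace H] [RealHilbertSpace K] : RealHilbertSpace (WithLp 2 (H × K)) where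
  conj :=
    { toFun := fun x =>
        WithLp.toLp 2 (RealHilbertSpace.conj x.fst, RealHilbertSpace.conj x.snd)
      map_add' := fun x y => by
        apply (WithLp.equiv 2 (H × K)).injective
        exact Prod.ext (map_add _ _ _) (map_add _ _ _)
      map_smul' := fun c x => by
        apply (WithLp.equiv 2 (H × K)).injective
        exact Prod.ext (LinearMap.map_smulₛₗ _ _ _) (LinearMap.map_smulₛₗ _ _ _) }
  conj_conj x := by
    apply (WithLp.equiv 2 (H × K)).injective
    exact Prod.ext (RealHilbertSpace.conj_conj _) (RealHilbertSpace.conj_conj _)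
  inner_conj x y := by
    rw [WithLp.prod_inner_apply, WithLp.prod_inner_apply, star_add]
    exact congrArg₂ (· + ·) (RealHilbertSpace.inner_conj _ _) (RealHilbertSpace.inner_conj _ _)
  conj_parity x := by
    apply (WithLp.equiv 2 (H × K)).injective
    exact Prod.ext (RealHilbertSpace.conj_parity _) (RealHilbertSpace.conj_parity _)

/-- An even isometry. -/
structure EvenIsometry (H K : Type v) [NormedAddCommGroup H] [InnerProductSpace ℂ H]
    [GradedHilbertSpace H] [NormedAddCommGroup K] [InnerProductSpace ℂ K]
    [GradedHilbertSpace K] where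
  toLinearIsometry : H →ₗᵢ[ℂ] K
  map_parity : ∀ x, toLinearIsometry (parity x) = parity (toLinearIsometry x)

/-- An even unitary. -/
structure EvenUnitary (H K : Type v) [NormedAddCommGroup H] [InnerProductSpace ℂ H]
    [GradedHilbertSpace H] [NormedAddCommGroup K] [InnerProductSpace ℂ K]
    [GradedHilbertSpace K] where
  toLinearIsometryEquiv : H ≃ₗᵢ[ℂ] K
  map_parity : ∀ x, toLinearIsometryEquiv (parity x) = parity (toLinearIsometryEquiv x)

/-- An even unitary is an even isometry. -/
def EvenUnitary.toEvenIsometry (u : EvenUnitary H K) : EvenIsometry H K :=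
  ⟨u.toLinearIsometryEquiv.toLinearIsometry, u.map_parity⟩

/-- An even isometry is Real if it commutes with the Real structures. -/
def EvenIsometry.IsReal [RealHilbertSpace H] [RealHilbertSpace K] (ι : EvenIsometry H K) : Prop :=
  ∀ x, ι.toLinearIsometry (RealHilbertSpace.conj x) = RealHilbertSpace.conj (ι.toLinearIsometry x)

/-- An even unitary is Real if it commutes with the Real structures. -/
def EvenUnitary.IsReal [RealHilbertSpace H] [RealHilbertSpace K] (u : EvenUnitary H K) : Prop :=
  u.toEvenIsometry.IsReal

variable (H K) in
/-- The inclusion `H → H ⊕ K` of the first summand. -/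
def inl : EvenIsometry H (WithLp 2 (H × K)) where
  toLinearIsometry :=
    { toFun := fun x => WithLp.toLp 2 (x, 0)
      map_add' := fun x y => by rw [← WithLp.toLp_add, Prod.mk_add_mk, add_zero]
      map_smul' := fun c x => by rw [RingHom.id_apply, ← WithLp.toLp_smul, Prod.smul_mk, smul_zero]
      norm_map' := fun x => WithLp.norm_toLp_fst 2 H K x }
  map_parity x := by
    apply (WithLp.equiv 2 (H × K)).injective
    exact Prod.ext rfl (map_zero parity).symm

variable (H K) in
/-- The inclusion `K → H ⊕ K` of the second summand. -/
def inr : EvenIsometry K (WithLp 2 (H × K)) where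
  toLinearIsometry :=
    { toFun := fun x => WithLp.toLp 2 (0, x)
      map_add' := fun x y => by rw [← WithLp.toLp_add, Prod.mk_add_mk, add_zero]
      map_smul' := fun c x => by rw [RingHom.id_apply, ← WithLp.toLp_smul, Prod.smul_mk, smul_zero]
      norm_map' := fun x => WithLp.norm_toLp_snd 2 H K x }
  map_parity x := by
    apply (WithLp.equiv 2 (H × K)).injective
    exact Prod.ext (map_zero parity).symm rfl

theorem inl_isReal [RealHilbertSpace H] [RealHilbertSpace K] : (inl H K).IsReal := fun x => by
  apply (WithLp.equiv 2 (H × K)).injective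
  exact Prod.ext rfl (map_zero RealHilbertSpace.conj).symm

theorem inr_isReal [RealHilbertSpace H] [RealHilbertSpace K] : (inr H K).IsReal := fun x => by
  apply (WithLp.equiv 2 (H × K)).injective
  exact Prod.ext (map_zero RealHilbertSpace.conj).symm rfl

theorem inner_inl_inr (x : H) (y : K) :
    inner ℂ ((inl H K).toLinearIsometry x) ((inr H K).toLinearIsometry y) = 0 := by
  rw [WithLp.prod_inner_apply]
  change inner ℂ x 0 + inner ℂ 0 y = 0
  rw [inner_zero_left, inner_zero_right, add_zero]

/-! ### Compact operators -/

open ContinuousLinearMap in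
/-- The adjoint of a compact operator is compact. -/
theorem isCompactOperator_adjoint {T : H →L[ℂ] H} (hT : IsCompactOperator T) :
    IsCompactOperator (adjoint T) := by
  have h2 : IsCompactOperator (T ∘L adjoint T) := hT.comp_clm (adjoint T)
  have hcl := (isCompactOperator_iff_isCompact_closure_image_closedBall
    ((T ∘L adjoint T : H →L[ℂ] H) : H →ₗ[ℂ] H) zero_lt_one).1 h2
  have htb := hcl.totallyBounded.subset subset_closure
  change IsCompactOperator ((adjoint T : H →L[ℂ] H) : H →ₗ[ℂ] H)
  rw [isCompactOperator_iff_isCompact_closure_image_closedBall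
    ((adjoint T : H →L[ℂ] H) : H →ₗ[ℂ] H) zero_lt_one]
  refine TotallyBounded.isCompact_of_isClosed (TotallyBounded.closure ?_) isClosed_closure
  rw [Metric.totallyBounded_iff]
  intro ε hε
  obtain ⟨t, hts, htf, hcov⟩ := totallyBounded_iff_subset.1 htb _
    (Metric.dist_mem_uniformity (show 0 < ε ^ 2 / 2 by positivity))
  obtain ⟨s, hs, hsf, rfl⟩ := Set.exists_subset_image_finite_and.1 ⟨t, hts, htf, rfl⟩
  refine ⟨_, hsf.image (adjoint T), ?_⟩
  rintro _ ⟨x, hx, rfl⟩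
  obtain ⟨_, ⟨y, hy, rfl⟩, hxy⟩ := Set.mem_iUnion₂.1 (hcov ⟨x, hx, rfl⟩)
  refine Set.mem_iUnion₂.2 ⟨_, ⟨y, hy, rfl⟩, ?_⟩
  have hxy' : ‖T (adjoint T (x - y))‖ < ε ^ 2 / 2 := by
    have h : dist (T (adjoint T x)) (T (adjoint T y)) < ε ^ 2 / 2 := hxy
    rwa [dist_eq_norm, ← map_sub, ← map_sub] at h
  have hn : ‖x - y‖ ≤ 2 := by
    have h1 : ‖x‖ ≤ 1 := by simpa using hx
    have h2 : ‖y‖ ≤ 1 := by simpa using hs hy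
    linarith [norm_sub_le x y]
  have hsq : ‖adjoint T (x - y)‖ ^ 2 < ε ^ 2 := by
    have h3 : ‖adjoint T (x - y)‖ ^ 2 = ‖inner ℂ (x - y) (T (adjoint T (x - y)))‖ := by
      rw [← adjoint_inner_left, inner_self_eq_norm_sq_to_K]
      simp
    rw [h3]
    calc ‖inner ℂ (x - y) (T (adjoint T (x - y)))‖ ≤ ‖x - y‖ * ‖T (adjoint T (x - y))‖ :=
          norm_inner_le_norm _ _
      _ ≤ 2 * ‖T (adjoint T (x - y))‖ := by gcongr
      _ < ε ^ 2 := by linarith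
  change dist (adjoint T x) (adjoint T y) < ε
  rw [dist_eq_norm, ← map_sub]
  exact lt_of_pow_lt_pow_left₀ 2 hε.le hsq

variable (H) in
/-- The compact operators as a `*`-subalgebra of the bounded operators. -/
def compactSubalgebra : NonUnitalStarSubalgebra ℂ (H →L[ℂ] H) where
  carrier := {T | IsCompactOperator T}
  add_mem' hS hT := hS.add hT
  zero_mem' := isCompactOperator_zero
  mul_mem' {_ T} hS _ := hS.comp_clm T
  smul_mem' c _ hT := hT.smul c
  star_mem' hT := isCompactOperator_adjoint hT

instance : IsClosed (compactSubalgebra H : Set (H →L[ℂ] H)) :=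
  isClosed_setOfPred_isCompactOperator

variable (H) in
/-- The C*-algebra `𝒦(H)` of compact operators. -/
def CompactOp : Type v := compactSubalgebra H

namespace CompactOp

instance : NonUnitalCStarAlgebra (CompactOp H) :=
  inferInstanceAs (NonUnitalCStarAlgebra (compactSubalgebra H))

/-- The underlying bounded operator. -/
def val (T : CompactOp H) : H →L[ℂ] H := Subtype.val T

theorem ext {S T : CompactOp H} (h : ∀ x, S.val x = T.val x) : S = T :=
  Subtype.ext (ContinuousLinearMap.ext h)

open ContinuousLinearMap in
/-- Conjugation by an isometry, `T ↦ ι T ι*`. -/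
def ad (ι : H →ₗᵢ[ℂ] K) : CompactOp H →⋆ₙₐ[ℂ] CompactOp K where
  toFun T := ⟨ι.toContinuousLinearMap ∘L T.val ∘L adjoint ι.toContinuousLinearMap,
    (T.2.comp_clm (adjoint ι.toContinuousLinearMap)).clm_comp ι.toContinuousLinearMap⟩
  map_smul' c T := ext fun x => map_smul ι c _
  map_zero' := ext fun x => map_zero ι
  map_add' T T' := ext fun x => map_add ι _ _
  map_mul' T T' := ext fun x => by
    change ι (T.val (T'.val _)) = ι (T.val (adjoint ι.toContinuousLinearMap (ι (T'.val _))))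
    congr 2
    exact (congrArg (fun f : H →L[ℂ] H => f (T'.val _))
      ((norm_map_iff_adjoint_comp_self ι.toContinuousLinearMap).1 ι.norm_map)).symm
  map_star' T := Subtype.ext <| by
    change ι.toContinuousLinearMap ∘L adjoint T.val ∘L adjoint ι.toContinuousLinearMap =
      adjoint (ι.toContinuousLinearMap ∘L T.val ∘L adjoint ι.toContinuousLinearMap)
    rw [adjoint_comp, adjoint_comp, adjoint_adjoint, comp_assoc]

open ContinuousLinearMap in
theorem ad_val (ι : H →ₗᵢ[ℂ] K) (T : CompactOp H) (x : K) :
    (ad ι T).val x = ι (T.val (adjoint ι.toContinuousLinearMap x)) := rfl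

open ContinuousLinearMap in
theorem adjoint_parity (x : H) :
    adjoint (parity : H →ₗᵢ[ℂ] H).toContinuousLinearMap x = parity x := by
  refine ext_inner_left ℂ fun y => ?_
  rw [adjoint_inner_right]
  change inner ℂ (parity y) x = inner ℂ y (parity x)
  rw [← (parity : H →ₗᵢ[ℂ] H).inner_map_map, parity_parity]

/-- The diagonal-off-diagonal grading `T ↦ γ T γ` of the compact operators. -/
instance : GradedCStarAlgebra (CompactOp H) where
  grading := ad parity
  grading_grading T := ext fun x => by
    rw [ad_val, ad_val, adjoint_parity, adjoint_parity, parity_parity, parity_parity]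

theorem gr_val (T : CompactOp H) (x : H) : (gr T).val x = parity (T.val (parity x)) := by
  change (ad parity T).val x = _
  rw [ad_val, adjoint_parity]

/-- The Real structure `τ(T)x = \overline{T x̄}` of the compact operators. -/
instance [RealHilbertSpace H] : RealCStarAlgebra (CompactOp H) where
  conj :=
    { toFun := fun T => ⟨(hconj.comp (T.val.comp hconj) : H →L[ℂ] H),
        IsCompactOperator.clm_comp (T.2.comp_clm (hconj : H →L⋆[ℂ] H)) (hconj : H →L⋆[ℂ] H)⟩
      map_add' := fun T T' => ext fun x => map_add hconj _ _
      map_smul' := fun c T => ext fun x => map_smulₛₗ hconj c _ }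
  conj_mul T T' := ext fun x => by
    change hconj (T.val (T'.val (hconj x))) = hconj (T.val (hconj (hconj (T'.val (hconj x)))))
    rw [hconj_hconj]
  conj_star T := ext fun x => by
    refine ext_inner_left ℂ fun y => ?_
    change inner ℂ y (hconj (ContinuousLinearMap.adjoint T.val (hconj x))) =
      inner ℂ y (ContinuousLinearMap.adjoint (hconj.comp (T.val.comp hconj) : H →L[ℂ] H) x)
    rw [ContinuousLinearMap.adjoint_inner_right]
    change _ = inner ℂ (hconj (T.val (hconj y))) x
    have h : ∀ a b : H, inner ℂ a (hconj b) = star (inner ℂ (hconj a) b) := fun a b => by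
      have := RealHilbertSpace.inner_conj (hconj a) b
      rw [← hconj_apply, ← hconj_apply, hconj_hconj] at this
      exact this
    have h' : ∀ a b : H, inner ℂ (hconj a) b = star (inner ℂ a (hconj b)) := fun a b => by
      rw [h, star_star]
    rw [h, ContinuousLinearMap.adjoint_inner_right, ← h']
  conj_conj T := ext fun x => by
    change hconj (hconj (T.val (hconj (hconj x)))) = T.val x
    rw [hconj_hconj, hconj_hconj]
  conj_grading T := ext fun x => by
    change hconj ((gr T).val (hconj x)) = (gr (_ : CompactOp H)).val x
    rw [gr_val, gr_val]
    change RealHilbertSpace.conj (parity (T.val (parity (RealHilbertSpace.conj x)))) =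
      parity (RealHilbertSpace.conj (T.val (RealHilbertSpace.conj (parity x))))
    rw [RealHilbertSpace.conj_parity, RealHilbertSpace.conj_parity]

theorem cj_val [RealHilbertSpace H] (T : CompactOp H) (x : H) :
    (cj T).val x = hconj (T.val (hconj x)) := rfl

open ContinuousLinearMap in
theorem adjoint_evenIsometry_parity (ι : EvenIsometry H K) (x : K) :
    adjoint ι.toLinearIsometry.toContinuousLinearMap (parity x) =
      parity (adjoint ι.toLinearIsometry.toContinuousLinearMap x) := by
  refine ext_inner_left ℂ fun y => ?_
  rw [adjoint_inner_right, ← (parity : H →ₗᵢ[ℂ] H).inner_map_map y, parity_parity,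
    adjoint_inner_right]
  change inner ℂ (ι.toLinearIsometry y) (parity x) = inner ℂ (ι.toLinearIsometry (parity y)) x
  rw [← (parity : K →ₗᵢ[ℂ] K).inner_map_map _ (parity x), parity_parity, ι.map_parity]

/-- Conjugation by an even isometry, `Ad(ι)(T) = ι T ι*`, is a graded `*`-homomorphism. -/
def Ad (ι : EvenIsometry H K) : GradedHom (CompactOp H) (CompactOp K) where
  toNonUnitalStarAlgHom := ad ι.toLinearIsometry
  map_gr' T := ext fun x => by
    change (ad ι.toLinearIsometry (gr T)).val x = (gr (ad ι.toLinearIsometry T)).val x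
    rw [ad_val, gr_val, gr_val, ad_val, ι.map_parity, adjoint_evenIsometry_parity]

theorem Ad_val (ι : EvenIsometry H K) (T : CompactOp H) (x : K) :
    (Ad ι T).val x = ι.toLinearIsometry
      (T.val (ContinuousLinearMap.adjoint ι.toLinearIsometry.toContinuousLinearMap x)) := rfl

open ContinuousLinearMap in
theorem adjoint_conj [RealHilbertSpace H] [RealHilbertSpace K] (ι : EvenIsometry H K)
    (hι : ι.IsReal) (x : K) :
    adjoint ι.toLinearIsometry.toContinuousLinearMap (RealHilbertSpace.conj x) =
      RealHilbertSpace.conj (adjoint ι.toLinearIsometry.toContinuousLinearMap x) := by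
  refine ext_inner_left ℂ fun y => ?_
  obtain ⟨y, rfl⟩ : ∃ z, RealHilbertSpace.conj z = y :=
    ⟨RealHilbertSpace.conj y, RealHilbertSpace.conj_conj y⟩
  rw [adjoint_inner_right, RealHilbertSpace.inner_conj, adjoint_inner_right]
  change inner ℂ (ι.toLinearIsometry (RealHilbertSpace.conj y)) _ = _
  rw [hι, RealHilbertSpace.inner_conj]
  rfl

theorem Ad_cj [RealHilbertSpace H] [RealHilbertSpace K] (ι : EvenIsometry H K)
    (hι : ι.IsReal) (T : CompactOp H) : Ad ι (cj T) = cj (Ad ι T) := ext fun x => by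
  rw [Ad_val, cj_val, cj_val, Ad_val, hconj_apply, hconj_apply, hconj_apply, hconj_apply, hι,
    adjoint_conj ι hι]

open ContinuousLinearMap in
theorem Ad_inl_mul_Ad_inr (T : CompactOp H) (T' : CompactOp K) :
    Ad (inl H K) T * Ad (inr H K) T' = 0 := ext fun x => by
  change (Ad (inl H K) T).val ((Ad (inr H K) T').val x) = 0
  rw [Ad_val, Ad_val]
  have h : ∀ y : K, adjoint (inl H K).toLinearIsometry.toContinuousLinearMap
      ((inr H K).toLinearIsometry y) = 0 := fun y => by
    refine ext_inner_left ℂ fun z => ?_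
    rw [adjoint_inner_right, inner_zero_right]
    exact inner_inl_inr z y
  rw [h, map_zero, map_zero]

end CompactOp

end Hilbert

/-! ## The spectral K-theory space -/

section KSpace

/-- The spectral K-theory space `𝕂(A, H) = Hom(C₀(ℝ), A ⊗ 𝒦(H))` of graded `*`-homomorphisms, with
the point-norm topology and the base point `0`. -/
abbrev KSpace (A : Type u) [NonUnitalCStarAlgebra A] [GradedCStarAlgebra A]
    (H : Type v) [NormedAddCommGroup H] [InnerProductSpace ℂ H] [CompleteSpace H]
    [GradedHilbertSpace H] : Type (max u v) :=
  GradedHom S (GTensor A (CompactOp H))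

/-- The spectral K-theory space in the Real case: the graded Real `*`-homomorphisms. -/
abbrev RealKSpace (A : Type u) [NonUnitalCStarAlgebra A] [GradedCStarAlgebra A]
    [RealCStarAlgebra A]
    (H : Type v) [NormedAddCommGroup H] [InnerProductSpace ℂ H] [CompleteSpace H]
    [GradedHilbertSpace H] [RealHilbertSpace H] : Type (max u v) :=
  RealGradedHom S (GTensor A (CompactOp H))

variable {A : Type u} [NonUnitalCStarAlgebra A] [GradedCStarAlgebra A]
  {H K : Type v} [NormedAddCommGroup H] [InnerProductSpace ℂ H] [CompleteSpace H]
  [GradedHilbertSpace H]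
  [NormedAddCommGroup K] [InnerProductSpace ℂ K] [CompleteSpace K] [GradedHilbertSpace K]

variable (A) in
/-- The graded `*`-homomorphism `1 ⊗ Ad(ι)`. -/
def tensorAd (ι : EvenIsometry H K) :
    GradedHom (GTensor A (CompactOp H)) (GTensor A (CompactOp K)) :=
  GTensor.map (GradedHom.id A) (CompactOp.Ad ι)

theorem tensorAd_mul_tensorAd (x : GTensor A (CompactOp H)) (y : GTensor A (CompactOp K)) :
    tensorAd A (inl H K) x * tensorAd A (inr H K) y = 0 := by
  refine GTensor.ind₁ x (isClosed_eq ((GTensor.continuous_map _ _).mul continuous_const)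
    continuous_const) fun x => ?_
  refine GTensor.ind₁ y (isClosed_eq (continuous_const.mul (GTensor.continuous_map _ _))
    continuous_const) fun y => ?_
  rw [tensorAd, tensorAd, GTensor.map_of, GTensor.map_of, ← GTensor.of_mul]
  rw [show AlgTensor.map (GradedHom.id A) (CompactOp.Ad (inl H K)) x *
    AlgTensor.map (GradedHom.id A) (CompactOp.Ad (inr H K)) y = 0 from ?_, map_zero]
  induction x using AlgTensor.induction_hom with
  | zero => simp
  | add x x' h h' => simp only [map_add, add_mul, h, h', add_zero]
  | even a T hT =>
    induction y using AlgTensor.induction_on with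
    | zero => simp
    | add y y' h h' => simp only [map_add, mul_add, h, h', add_zero]
    | tmul a' T' =>
      rw [AlgTensor.map_tmul, AlgTensor.map_tmul,
        AlgTensor.tmul_mul_even _ _ _ (GradedHom.isEvenElem _ hT), CompactOp.Ad_inl_mul_Ad_inr,
        AlgTensor.tmul_zero]
  | odd a T hT =>
    induction y using AlgTensor.induction_on with
    | zero => simp
    | add y y' h h' => simp only [map_add, mul_add, h, h', add_zero]
    | tmul a' T' =>
      rw [AlgTensor.map_tmul, AlgTensor.map_tmul,
        AlgTensor.tmul_mul_odd _ _ _ (GradedHom.isOddElem _ hT), CompactOp.Ad_inl_mul_Ad_inr,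
        AlgTensor.tmul_zero]

theorem tensorAd_mul_tensorAd' (x : GTensor A (CompactOp H)) (y : GTensor A (CompactOp K)) :
    tensorAd A (inr H K) y * tensorAd A (inl H K) x = 0 := by
  have h := congrArg star (tensorAd_mul_tensorAd (star x) (star y))
  have hl : tensorAd A (inl H K) (star x) = star (tensorAd A (inl H K) x) :=
    map_star (tensorAd A (inl H K)).toNonUnitalStarAlgHom x
  have hr : tensorAd A (inr H K) (star y) = star (tensorAd A (inr H K) y) :=
    map_star (tensorAd A (inr H K)).toNonUnitalStarAlgHom y
  rwa [hl, hr, star_mul, star_star, star_star, star_zero] at h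

/-- The sum map `s : 𝕂(A, H) × 𝕂(A, K) → 𝕂(A, H ⊕ K)`. It sends `(φ, ψ)` to the composite
`S → S ⊕ S → A ⊗ 𝒦(H) ⊕ A ⊗ 𝒦(K) ≅ A ⊗ (𝒦(H) ⊕ 𝒦(K)) → A ⊗ 𝒦(H ⊕ K)` of the diagonal, `φ ⊕ ψ`, the
natural isomorphism and the inclusion of the block diagonal operators, that is, to
`f ↦ (1 ⊗ Ad(i₁))(φ f) + (1 ⊗ Ad(i₂))(ψ f)` for the inclusions `i₁, i₂` of the two summands. -/
def sum (φ : KSpace A H) (ψ : KSpace A K) : KSpace A (WithLp 2 (H × K)) where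
  toFun f := tensorAd A (inl H K) (φ f) + tensorAd A (inr H K) (ψ f)
  map_smul' c f := by
    have h1 := map_smul ((tensorAd A (inl H K)).comp φ).toNonUnitalStarAlgHom c f
    have h2 := map_smul ((tensorAd A (inr H K)).comp ψ).toNonUnitalStarAlgHom c f
    exact (congrArg₂ (· + ·) h1 h2).trans (smul_add c _ _).symm
  map_zero' := by
    have h1 := map_zero ((tensorAd A (inl H K)).comp φ).toNonUnitalStarAlgHom
    have h2 := map_zero ((tensorAd A (inr H K)).comp ψ).toNonUnitalStarAlgHom
    exact (congrArg₂ (· + ·) h1 h2).trans (add_zero _)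
  map_add' f g := by
    have h1 := map_add ((tensorAd A (inl H K)).comp φ).toNonUnitalStarAlgHom f g
    have h2 := map_add ((tensorAd A (inr H K)).comp ψ).toNonUnitalStarAlgHom f g
    exact (congrArg₂ (· + ·) h1 h2).trans (add_add_add_comm _ _ _ _)
  map_mul' f g := by
    have h1 : tensorAd A (inl H K) (φ (f * g)) =
        tensorAd A (inl H K) (φ f) * tensorAd A (inl H K) (φ g) :=
      map_mul ((tensorAd A (inl H K)).comp φ).toNonUnitalStarAlgHom f g
    have h2 : tensorAd A (inr H K) (ψ (f * g)) =
        tensorAd A (inr H K) (ψ f) * tensorAd A (inr H K) (ψ g) :=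
      map_mul ((tensorAd A (inr H K)).comp ψ).toNonUnitalStarAlgHom f g
    rw [h1, h2, add_mul, mul_add, mul_add, tensorAd_mul_tensorAd, tensorAd_mul_tensorAd', add_zero,
      zero_add]
  map_star' f := by
    have h1 := map_star ((tensorAd A (inl H K)).comp φ).toNonUnitalStarAlgHom f
    have h2 := map_star ((tensorAd A (inr H K)).comp ψ).toNonUnitalStarAlgHom f
    exact (congrArg₂ (· + ·) h1 h2).trans (star_add _ _).symm
  map_gr' f := by
    have h1 := ((tensorAd A (inl H K)).comp φ).map_gr f
    have h2 := ((tensorAd A (inr H K)).comp ψ).map_gr f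
    exact (congrArg₂ (· + ·) h1 h2).trans (map_add gr _ _).symm

theorem sum_apply (φ : KSpace A H) (ψ : KSpace A K) (f : S) :
    sum φ ψ f = tensorAd A (inl H K) (φ f) + tensorAd A (inr H K) (ψ f) := rfl

variable (A) in
/-- The map `μ_u : 𝕂(A, H) × 𝕂(A, H) → 𝕂(A, H)`: the sum map followed by `1 ⊗ Ad(u)`, for an even
unitary `u : H ⊕ H → H`. -/
def mu (u : EvenUnitary (WithLp 2 (H × H)) H) (p : KSpace A H × KSpace A H) : KSpace A H :=
  (tensorAd A u.toEvenIsometry).comp (sum p.1 p.2)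

section Real

variable [RealCStarAlgebra A] [RealHilbertSpace H] [RealHilbertSpace K]

theorem tensorAd_cj (ι : EvenIsometry H K) (hι : ι.IsReal) (x : GTensor A (CompactOp H)) :
    tensorAd A ι (cj x) = cj (tensorAd A ι x) :=
  GTensor.map_cj _ _ (fun _ => rfl) (CompactOp.Ad_cj ι hι) x

/-- The sum of two graded Real `*`-homomorphisms. -/
def realSum (φ : RealKSpace A H) (ψ : RealKSpace A K) : RealKSpace A (WithLp 2 (H × K)) :=
  ⟨sum φ.1 ψ.1, fun f => by
    rw [sum_apply, sum_apply, φ.2, ψ.2, tensorAd_cj _ inl_isReal, tensorAd_cj _ inr_isReal,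
      map_add]⟩

variable (A) in
/-- The map `μ_u` in the Real case, for an even Real unitary `u`. -/
def realMu (u : EvenUnitary (WithLp 2 (H × H)) H) (hu : u.IsReal)
    (p : RealKSpace A H × RealKSpace A H) : RealKSpace A H :=
  ⟨(tensorAd A u.toEvenIsometry).comp (realSum p.1 p.2).1, fun f => by
    rw [GradedHom.comp_apply, GradedHom.comp_apply, (realSum p.1 p.2).2, tensorAd_cj _ hu]⟩

end Real

end KSpace

/-! ## Commutative H-monoids -/

open ContinuousMap in
/-- A pointed space `(X, e)` with a map `μ : X × X → X` is a commutative H-monoid if it is an H-space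
(`μ` is continuous and `μ(e, -)` and `μ(-, e)` are homotopic to the identity relative to `e`) which
is homotopy associative and homotopy commutative, all homotopies being based. -/
def IsCommutativeHMonoid {X : Type w} [TopologicalSpace X] (μ : X × X → X) (e : X) : Prop :=
  ∃ h : HSpace X, ⇑h.hmul = μ ∧ h.e = e ∧
    (h.hmul.comp ((h.hmul.comp (fst.prodMk (fst.comp snd))).prodMk (snd.comp snd))).HomotopicRel
      (h.hmul.comp (fst.prodMk (h.hmul.comp snd)) : C(X × X × X, X)) {(e, e, e)} ∧
    h.hmul.HomotopicRel (h.hmul.comp (snd.prodMk fst)) {(e, e)}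

end SpectralK

end

noncomputable section

namespace SpectralK

/-! ## Strongly continuous paths of isometries -/

section Isometries

open Filter Topology Set

variable {H : Type v} [NormedAddCommGroup H] [InnerProductSpace ℂ H] [CompleteSpace H]

/-! Every composite of copies of `μ_u` has the form `f ↦ ∑ᵢ (1 ⊗ Ad(Vᵢ))(φᵢ f)`, where the `Vᵢ` are
even isometries of `H` with pairwise orthogonal ranges. For instance, with `l`, `r` the restrictions
of `u` to the two summands, the two bracketings of a triple sum belong to the families `(ll, lr, r)`
and `(l, rl, rr)`. The unit law compares the one-element families `l` or `r` with the identity, and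
commutativity compares `(l, r)` with `(r, l)`. It therefore suffices to join any two such families
of the same length by a strongly continuous path of such families (`joinedIn_orthoFamilies`) and to
turn the path into a based homotopy (`homotopicRel_of_joinedIn`).

The path has two ingredients. If all ranges of one family are orthogonal to all ranges of another,
the rotation `cos · V + sin · W` joins them (`joinedIn_of_orthogonal`). Secondly, a single isometry
`v` is joined to a self-adjoint unitary `G` by the isometries `(v + r)(1 + rv)⁻¹`, `0 ≤ r < 1`,
which converge strongly to a reflection as `r → 1`. Since `G² = 1`, the family `G v U` is then
joined to `U` (`joinedIn_cayley`). Given `v₁`, `v₂` with orthogonal ranges and `G` the limit for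
`v₂`, every family `U` is joined to `G v₂ U` and then rotated to `G v₁ V`, where `V` is any fixed
family. The unitary `u` supplies `v₁` and `v₂`.

The path becomes a homotopy because conjugating a compact operator by strongly continuous isometries
is norm continuous (`continuous_Ad`). This passes to the tensor product since all the homomorphisms
are contractive (`continuous_tensorAd`).

Evenness and reality are handled together: everything is required to commute with a set `𝒞` of
real-linear operators, namely the grading and, in the Real case, the conjugation. Only real scalars
occur in the paths, so antilinear operators are allowed in `𝒞`. -/

/-- The resolvent `(1 + rV)⁻¹`. -/
def cayleyInv (V : H →ₗᵢ[ℂ] H) (r : ℝ) : H →L[ℂ] H :=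
  Ring.inverse (1 + (r : ℂ) • V.toContinuousLinearMap)

theorem isUnit_one_add_smul (V : H →ₗᵢ[ℂ] H) {r : ℝ} (h0 : 0 ≤ r) (h1 : r < 1) :
    IsUnit (1 + (r : ℂ) • V.toContinuousLinearMap) := by
  rw [← sub_neg_eq_add]
  refine isUnit_one_sub_of_norm_lt_one ?_
  rw [norm_neg, norm_smul, Complex.norm_real, Real.norm_of_nonneg h0]
  exact (mul_le_of_le_one_right h0 V.norm_toContinuousLinearMap_le).trans_lt h1

theorem add_cayleyInv (V : H →ₗᵢ[ℂ] H) {r : ℝ} (h0 : 0 ≤ r) (h1 : r < 1) (x : H) :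
    cayleyInv V r x + (r : ℂ) • V (cayleyInv V r x) = x := by
  have h := Ring.mul_inverse_cancel _ (isUnit_one_add_smul V h0 h1)
  exact congrArg (fun T : H →L[ℂ] H => T x) h

theorem cayleyInv_add (V : H →ₗᵢ[ℂ] H) {r : ℝ} (h0 : 0 ≤ r) (h1 : r < 1) (x : H) :
    cayleyInv V r (x + (r : ℂ) • V x) = x := by
  have h := Ring.inverse_mul_cancel _ (isUnit_one_add_smul V h0 h1)
  exact congrArg (fun T : H →L[ℂ] H => T x) h

/-- With `z` the resolvent applied to `x`, isometry of `V` gives `‖z + rVz‖ ≥ (1 - r)‖z‖`. The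
resulting bound on the resolvent degenerates as `r → 1`, which is why the endpoint needs a separate
argument. -/
theorem norm_cayleyInv_le (V : H →ₗᵢ[ℂ] H) {r : ℝ} (h0 : 0 ≤ r) (h1 : r < 1) (x : H) :
    (1 - r) * ‖cayleyInv V r x‖ ≤ ‖x‖ := by
  set z := cayleyInv V r x with hz
  have h := norm_sub_le (z + (r : ℂ) • V z) ((r : ℂ) • V z)
  rw [add_sub_cancel_right, add_cayleyInv V h0 h1, norm_smul, V.norm_map, Complex.norm_real,
    Real.norm_of_nonneg h0] at h
  linarith

/-- An operator commuting with `V` commutes with the resolvents of `V`. -/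
theorem cayleyInv_comm (V : H →ₗᵢ[ℂ] H) {r : ℝ} (h0 : 0 ≤ r) (h1 : r < 1) (c : H →L[ℝ] H)
    (hc : ∀ x, V (c x) = c (V x)) (x : H) : cayleyInv V r (c x) = c (cayleyInv V r x) := by
  -- Write `x = (1 + rV)z`. Since `r` is real, a merely real-linear `c` can be moved past `1 + rV`,
  -- and the resolvent cancels.
  conv_lhs => rw [← add_cayleyInv V h0 h1 x]
  rw [map_add, Complex.coe_smul, map_smul, ← hc, ← Complex.coe_smul, cayleyInv_add V h0 h1]

theorem continuousOn_cayleyInv (V : H →ₗᵢ[ℂ] H) : ContinuousOn (cayleyInv V) (Ico 0 1) := by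
  intro r hr
  have h := isUnit_one_add_smul V hr.1 hr.2
  have h2 : ContinuousAt (Ring.inverse : (H →L[ℂ] H) → _)
      (1 + (r : ℂ) • V.toContinuousLinearMap) := by
    have := NormedRing.inverse_continuousAt h.unit
    rwa [h.unit_spec] at this
  refine (ContinuousAt.comp (f := fun r : ℝ => (1 + (r : ℂ) • V.toContinuousLinearMap)) h2
    ?_).continuousWithinAt
  fun_prop

/-- Expanding both squares, the diagonal terms agree because `V` is isometric and the cross terms
because `r` is real. This is what makes `(V + r)(1 + rV)⁻¹` isometric. -/
theorem norm_add_smul_symm (V : H →ₗᵢ[ℂ] H) (r : ℝ) (y : H) :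
    ‖V y + (r : ℂ) • y‖ = ‖y + (r : ℂ) • V y‖ := by
  rw [← sq_eq_sq₀ (norm_nonneg _) (norm_nonneg _), @norm_add_sq ℂ, @norm_add_sq ℂ, norm_smul,
    norm_smul, V.norm_map, inner_smul_right, inner_smul_right]
  simpa using Or.inl (inner_re_symm (𝕜 := ℂ) (V y) y)

/-! ### The Cayley-type transform and its strong limit -/

/-- The Cayley-type transform `(V + r)(1 + rV)⁻¹` of an isometry, for `0 ≤ r < 1`. -/
def cayley (V : H →ₗᵢ[ℂ] H) (r : ℝ) (h0 : 0 ≤ r) (h1 : r < 1) : H →ₗᵢ[ℂ] H where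
  toLinearMap := (V.toContinuousLinearMap + (r : ℂ) • (1 : H →L[ℂ] H)) ∘L cayleyInv V r
  norm_map' x := by
    change ‖V (cayleyInv V r x) + (r : ℂ) • cayleyInv V r x‖ = ‖x‖
    rw [norm_add_smul_symm, add_cayleyInv V h0 h1]

theorem cayley_apply (V : H →ₗᵢ[ℂ] H) {r : ℝ} (h0 : 0 ≤ r) (h1 : r < 1) (x : H) :
    cayley V r h0 h1 x = V (cayleyInv V r x) + (r : ℂ) • cayleyInv V r x := rfl

/-- The closure of the range of `1 + V`. -/
def onePlusRange (V : H →ₗᵢ[ℂ] H) : Submodule ℂ H :=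
  (LinearMap.range (LinearMap.id + V.toLinearMap)).topologicalClosure

instance (V : H →ₗᵢ[ℂ] H) : CompleteSpace (onePlusRange V) :=
  (Submodule.isClosed_topologicalClosure _).completeSpace_coe

/-- Testing orthogonality against `x + Vx` alone gives `‖x‖² + Re⟨Vx, x⟩ = 0`, half of `‖x + Vx‖²`.
Conversely, if `Vx = -x`, then `⟨y, x⟩ = ⟨Vy, Vx⟩ = -⟨Vy, x⟩`. -/
theorem mem_onePlusRange_orthogonal (V : H →ₗᵢ[ℂ] H) (x : H) :
    x ∈ (onePlusRange V)ᗮ ↔ V x = -x := by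
  rw [onePlusRange, Submodule.orthogonal_closure, Submodule.mem_orthogonal]
  constructor
  · intro h
    have h1 : inner ℂ (x + V x) x = 0 := h _ ⟨x, rfl⟩
    rw [inner_add_left] at h1
    rw [← sub_eq_zero, sub_neg_eq_add, ← norm_eq_zero, ← sq_eq_zero_iff, @norm_add_sq ℂ,
      V.norm_map]
    have h2 := congrArg RCLike.re h1
    rw [map_add, inner_self_eq_norm_sq, map_zero] at h2
    linarith
  · rintro h _ ⟨y, rfl⟩
    change inner ℂ (y + V y) x = 0
    have h1 := V.inner_map_map y x
    rw [h, inner_neg_right] at h1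
    rw [inner_add_left, ← h1, neg_add_cancel]

/-- The reflection in the closure of the range of `1 + V`: the strong limit of the Cayley-type
transforms of `V`. -/
def cayleyLimit (V : H →ₗᵢ[ℂ] H) : H ≃ₗᵢ[ℂ] H := (onePlusRange V).reflection

theorem cayleyLimit_involutive (V : H →ₗᵢ[ℂ] H) (x : H) :
    cayleyLimit V (cayleyLimit V x) = x := Submodule.reflection_reflection _ x

theorem cayleyLimit_of_mem (V : H →ₗᵢ[ℂ] H) {x : H} (hx : x ∈ onePlusRange V) :
    cayleyLimit V x = x := Submodule.reflection_mem_subspace_eq_self hx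

theorem cayleyLimit_of_mem_orthogonal (V : H →ₗᵢ[ℂ] H) {x : H} (hx : x ∈ (onePlusRange V)ᗮ) :
    cayleyLimit V x = -x := Submodule.reflection_mem_subspace_orthogonalComplement_eq_neg hx

theorem exists_onePlusRange_add (V : H →ₗᵢ[ℂ] H) (x : H) :
    ∃ a ∈ onePlusRange V, ∃ b ∈ (onePlusRange V)ᗮ, a + b = x := by
  obtain ⟨a, ha, b, hb, h⟩ := (onePlusRange V).exists_add_mem_mem_orthogonal x
  exact ⟨a, ha, b, hb, h.symm⟩

/-- A reflection commutes with `c` as soon as `c` preserves both of its eigenspaces. No adjoint of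
`c` is needed, because the orthogonal complement is also the `-1` eigenspace of `V`. -/
theorem cayleyLimit_comm (V : H →ₗᵢ[ℂ] H) (c : H →L[ℝ] H) (hc : ∀ x, V (c x) = c (V x)) (x : H) :
    cayleyLimit V (c x) = c (cayleyLimit V x) := by
  obtain ⟨a, ha, b, hb, rfl⟩ := exists_onePlusRange_add V x
  have ha' : c a ∈ onePlusRange V := by
    refine map_mem_closure c.continuous ha ?_
    rintro _ ⟨y, rfl⟩
    refine ⟨c y, ?_⟩
    change c y + V (c y) = c (y + V y)
    rw [map_add, hc]
  have hb' : c b ∈ (onePlusRange V)ᗮ := by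
    rw [mem_onePlusRange_orthogonal] at hb ⊢
    rw [hc, hb, map_neg]
  rw [map_add, map_add, map_add, map_add, cayleyLimit_of_mem V ha, cayleyLimit_of_mem V ha',
    cayleyLimit_of_mem_orthogonal V hb, cayleyLimit_of_mem_orthogonal V hb', map_neg]

open scoped Classical in
/-- The path of isometries from `V` to `cayleyLimit V`, parametrized by `[0, 1]`. -/
def cayleyPath (V : H →ₗᵢ[ℂ] H) (r : ℝ) : H →ₗᵢ[ℂ] H :=
  if h : 0 ≤ r ∧ r < 1 then cayley V r h.1 h.2 else (cayleyLimit V).toLinearIsometry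

theorem cayleyPath_of_lt (V : H →ₗᵢ[ℂ] H) {r : ℝ} (h0 : 0 ≤ r) (h1 : r < 1) (x : H) :
    cayleyPath V r x = V (cayleyInv V r x) + (r : ℂ) • cayleyInv V r x := by
  rw [cayleyPath, dif_pos ⟨h0, h1⟩, cayley_apply]

theorem cayleyPath_zero (V : H →ₗᵢ[ℂ] H) (x : H) : cayleyPath V 0 x = V x := by
  have h := add_cayleyInv V le_rfl zero_lt_one x
  rw [cayleyPath_of_lt V le_rfl zero_lt_one]
  simp only [Complex.ofReal_zero, zero_smul, add_zero] at h ⊢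
  rw [h]

theorem cayleyPath_one (V : H →ₗᵢ[ℂ] H) (x : H) : cayleyPath V 1 x = cayleyLimit V x := by
  rw [cayleyPath, dif_neg (fun h => lt_irrefl _ h.2)]
  rfl

theorem cayleyPath_comm (V : H →ₗᵢ[ℂ] H) (c : H →L[ℝ] H) (hc : ∀ x, V (c x) = c (V x)) (r : ℝ)
    (x : H) : cayleyPath V r (c x) = c (cayleyPath V r x) := by
  by_cases h : 0 ≤ r ∧ r < 1
  · rw [cayleyPath_of_lt V h.1 h.2, cayleyPath_of_lt V h.1 h.2, cayleyInv_comm V h.1 h.2 c hc, hc,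
      map_add, Complex.coe_smul, Complex.coe_smul, map_smul]
  · rw [cayleyPath, dif_neg h]
    exact cayleyLimit_comm V c hc x

/-- With `z = (1 + rV)⁻¹(y + Vy)`, the difference is `(V + r)z - (1 + rV)z = (1 - r)(Vz - z)`, so a
bound on `z` uniform in `r` is enough. -/
theorem norm_cayleyPath_sub_le (V : H →ₗᵢ[ℂ] H) {r : ℝ} (h0 : 0 ≤ r) (h1 : r < 1) (y : H) :
    ‖cayleyPath V r (y + V y) - (y + V y)‖ ≤ 4 * (1 - r) * ‖y‖ := by
  set z := cayleyInv V r (y + V y) with hz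
  -- Splitting `y + Vy = (1 + rV)y + (1 - r)Vy` puts a factor `1 - r` before the resolvent; it
  -- compensates the growth of the resolvent and yields `‖z‖ ≤ 2‖y‖`.
  have e1 : z = y + ((1 - r : ℝ) : ℂ) • cayleyInv V r (V y) := by
    rw [hz]
    conv_lhs => rw [show y + V y = (y + (r : ℂ) • V y) + ((1 - r : ℝ) : ℂ) • V y by
      push_cast; module]
    rw [map_add, map_smul, cayleyInv_add V h0 h1]
  have e2 : cayleyPath V r (y + V y) - (y + V y) = ((1 - r : ℝ) : ℂ) • (V z - z) := by
    rw [cayleyPath_of_lt V h0 h1, ← hz]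
    conv_lhs => rw [← add_cayleyInv V h0 h1 (y + V y), ← hz]
    push_cast
    module
  have h2 := norm_cayleyInv_le V h0 h1 (V y)
  rw [V.norm_map] at h2
  have hz' : ‖z‖ ≤ 2 * ‖y‖ := by
    rw [e1]
    refine (norm_add_le _ _).trans ?_
    rw [norm_smul, Complex.norm_real, Real.norm_of_nonneg (by linarith)]
    linarith
  rw [e2, norm_smul, Complex.norm_real, Real.norm_of_nonneg (by linarith)]
  have h3 := norm_sub_le (V z) z
  rw [V.norm_map] at h3
  nlinarith

/-- On the range of `1 + V` the transforms tend to the identity by `norm_cayleyPath_sub_le`, and on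
its closure by equicontinuity, all of them being isometric. On the orthogonal complement they are
constantly `-1`. -/
theorem tendsto_cayleyPath (V : H →ₗᵢ[ℂ] H) (x : H) :
    Tendsto (fun r => cayleyPath V r x) (𝓝[<] 1) (𝓝 (cayleyLimit V x)) := by
  obtain ⟨a, ha, b, hb, rfl⟩ := exists_onePlusRange_add V x
  simp only [map_add]
  have hev : ∀ᶠ r : ℝ in 𝓝[<] 1, 0 ≤ r ∧ r < 1 :=
    Filter.Eventually.mono (Ico_mem_nhdsLT zero_lt_one) fun r hr => hr
  refine Tendsto.add ?_ ?_
  · rw [cayleyLimit_of_mem V ha]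
    rw [Metric.tendsto_nhds]
    intro ε hε
    obtain ⟨_, ⟨y, rfl⟩, hy⟩ := Metric.mem_closure_iff.1 ha (ε / 4) (by positivity)
    change dist a (y + V y) < ε / 4 at hy
    have hlim : Tendsto (fun r : ℝ => 4 * (1 - r) * ‖y‖) (𝓝[<] 1) (𝓝 (4 * (1 - 1) * ‖y‖)) :=
      (Continuous.tendsto (by fun_prop) 1).mono_left nhdsWithin_le_nhds
    rw [sub_self, mul_zero, zero_mul] at hlim
    filter_upwards [hev, hlim.eventually (gt_mem_nhds (show 0 < ε / 4 by positivity))] with r hr hr'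
    have h1 : dist (cayleyPath V r a) (cayleyPath V r (y + V y)) < ε / 4 := by
      rwa [(cayleyPath V r).dist_map]
    have h2 : dist (cayleyPath V r (y + V y)) (y + V y) < ε / 4 := by
      rw [dist_eq_norm]
      exact (norm_cayleyPath_sub_le V hr.1 hr.2 y).trans_lt hr'
    have h3 := dist_triangle4 (cayleyPath V r a) (cayleyPath V r (y + V y)) (y + V y) a
    have h4 := dist_comm (y + V y) a
    linarith
  · rw [cayleyLimit_of_mem_orthogonal V hb]
    refine tendsto_const_nhds.congr' ?_
    filter_upwards [hev] with r hr
    rw [mem_onePlusRange_orthogonal] at hb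
    -- From `Vb = -b`, `(1 + rV)b = (1 - r)b`, so the resolvent only rescales `b` and the transform
    -- is `(r - 1)/(1 - r) = -1` there.
    have h1 : ((1 - r : ℝ) : ℂ) • cayleyInv V r b = b := by
      have := cayleyInv_add V hr.1 hr.2 b
      rw [hb] at this
      conv_rhs => rw [← this]
      rw [← map_smul]
      congr 1
      push_cast
      module
    have h2 : V (cayleyInv V r b) = - cayleyInv V r b := by
      have h3 : ((1 - r : ℝ) : ℂ) ≠ 0 := by
        rw [Complex.ofReal_ne_zero]; linarith [hr.2]
      have : cayleyInv V r b = ((1 - r : ℝ) : ℂ)⁻¹ • b := by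
        rw [← h1, smul_smul, inv_mul_cancel₀ h3, one_smul, h1]
      rw [this, map_smul, hb, smul_neg]
    rw [cayleyPath_of_lt V hr.1 hr.2, h2]
    conv_lhs => rw [← h1]
    push_cast
    module

/-- On `[0, 1)` continuity comes from norm continuity of inversion; at `1` it holds only strongly,
by `tendsto_cayleyPath`. -/
theorem continuousOn_cayleyPath (V : H →ₗᵢ[ℂ] H) (x : H) :
    ContinuousOn (fun r => cayleyPath V r x) (Icc 0 1) := by
  have hI : ContinuousOn (fun r => cayleyPath V r x) (Ico 0 1) := by
    have hc : ContinuousOn (fun r => cayleyInv V r x) (Ico 0 1) :=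
      (continuousOn_cayleyInv V).clm_apply continuousOn_const
    refine ContinuousOn.congr (f := fun r : ℝ => V (cayleyInv V r x) + (r : ℂ) • cayleyInv V r x)
      ?_ fun r hr => cayleyPath_of_lt V hr.1 hr.2 x
    exact (V.continuous.comp_continuousOn hc).add
      (Complex.continuous_ofReal.continuousOn.smul hc)
  intro r hr
  rcases hr.2.lt_or_eq with h | rfl
  · refine (hI r ⟨hr.1, h⟩).mono_of_mem_nhdsWithin ?_
    filter_upwards [self_mem_nhdsWithin, mem_nhdsWithin_of_mem_nhds (Iio_mem_nhds h)] with s hs hs'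
    exact ⟨hs.1, hs'⟩
  · have h : ContinuousWithinAt (fun r => cayleyPath V r x) (Iio 1) 1 := by
      have := tendsto_cayleyPath V x
      rw [← cayleyPath_one] at this
      exact this
    refine (continuousWithinAt_insert_self.2 h).mono fun s hs => ?_
    rcases hs.2.lt_or_eq with h | rfl
    · exact Or.inr h
    · exact Or.inl rfl

/-! ### Path-connectedness of the space of orthogonal families -/

/-- The families of isometries with pairwise orthogonal ranges which commute with all the
operators in `𝒞`, as a subset of the space of functions with the topology of strong convergence. -/
def orthoFamilies (ι : Type*) (𝒞 : Set (H →L[ℝ] H)) : Set (ι → H → H) :=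
  {g | ∃ V : ι → H →ₗᵢ[ℂ] H, (∀ i, g i = V i) ∧
    (Pairwise fun i j => ∀ x y, inner ℂ (V i x) (V j y) = 0) ∧
    ∀ c ∈ 𝒞, ∀ i x, V i (c x) = c (V i x)}

variable {ι : Type*} {𝒞 : Set (H →L[ℝ] H)}

theorem comp_mem_orthoFamilies {V : ι → H →ₗᵢ[ℂ] H} (hV : (fun i => ⇑(V i)) ∈ orthoFamilies ι 𝒞)
    (w : H →ₗᵢ[ℂ] H) (hw : ∀ c ∈ 𝒞, ∀ x, w (c x) = c (w x)) :
    (fun i => ⇑(w.comp (V i))) ∈ orthoFamilies ι 𝒞 := by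
  obtain ⟨V', hVV', ho, hc⟩ := hV
  obtain rfl : V = V' := funext fun i => DFunLike.coe_injective (hVV' i)
  refine ⟨fun i => w.comp (V i), fun i => rfl, fun i j hij x y => ?_, fun c hcc i x => ?_⟩
  · exact (w.inner_map_map _ _).trans (ho hij x y)
  · exact (congrArg w (hc c hcc i x)).trans (hw c hcc _)

/-- Two orthogonal families with mutually orthogonal ranges are joined by a rotation. -/
theorem joinedIn_of_orthogonal {V W : ι → H →ₗᵢ[ℂ] H}
    (hV : (fun i => ⇑(V i)) ∈ orthoFamilies ι 𝒞) (hW : (fun i => ⇑(W i)) ∈ orthoFamilies ι 𝒞)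
    (h : ∀ i j x y, inner ℂ (V i x) (W j y) = 0) :
    JoinedIn (orthoFamilies ι 𝒞) (fun i => ⇑(V i)) (fun i => ⇑(W i)) := by
  obtain ⟨V', hVV', hVo, hVc⟩ := hV
  obtain rfl : V = V' := funext fun i => DFunLike.coe_injective (hVV' i)
  obtain ⟨W', hWW', hWo, hWc⟩ := hW
  obtain rfl : W = W' := funext fun i => DFunLike.coe_injective (hWW' i)
  have h' : ∀ i j x y, inner ℂ (W i x) (V j y) = 0 := fun i j x y => by
    rw [← inner_conj_symm, h, map_zero]
  let a : ℝ → ℝ := fun t => Real.cos (t * (Real.pi / 2))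
  let b : ℝ → ℝ := fun t => Real.sin (t * (Real.pi / 2))
  have hab : ∀ t, a t ^ 2 + b t ^ 2 = 1 := fun t => Real.cos_sq_add_sin_sq _
  -- The mixed products of `V` and `W` vanish. For `i = j` the formula makes the rotated operators
  -- isometric, since `a² + b² = 1`; for `i ≠ j` it makes their ranges orthogonal.
  have hinner : ∀ t i j x y, inner ℂ ((a t : ℂ) • V i x + (b t : ℂ) • W i x)
      ((a t : ℂ) • V j y + (b t : ℂ) • W j y) =
      (a t ^ 2 : ℂ) * inner ℂ (V i x) (V j y) + (b t ^ 2 : ℂ) * inner ℂ (W i x) (W j y) := by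
    intro t i j x y
    simp only [inner_add_left, inner_add_right, inner_smul_left, inner_smul_right, h, h',
      Complex.conj_ofReal]
    ring
  refine JoinedIn.ofLine (f := fun t i x => (a t : ℂ) • V i x + (b t : ℂ) • W i x)
    (Continuous.continuousOn ?_) ?_ ?_ ?_
  · refine continuous_pi fun i => continuous_pi fun x => ?_
    fun_prop
  · funext i x
    simp [a, b]
  · funext i x
    simp [a, b]
  · rintro _ ⟨t, -, rfl⟩
    refine ⟨fun i => ⟨(a t : ℂ) • (V i).toLinearMap + (b t : ℂ) • (W i).toLinearMap, fun x => ?_⟩,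
      fun i => rfl, fun i j hij x y => ?_, fun c hc i x => ?_⟩
    · change ‖(a t : ℂ) • V i x + (b t : ℂ) • W i x‖ = ‖x‖
      have h1 := hinner t i i x x
      rw [(V i).inner_map_map, (W i).inner_map_map, ← add_mul] at h1
      have h2 : (a t ^ 2 + b t ^ 2 : ℂ) = 1 := by exact_mod_cast hab t
      rw [h2, one_mul] at h1
      rw [@norm_eq_sqrt_re_inner ℂ, h1, ← @norm_eq_sqrt_re_inner ℂ]
    · refine (hinner t i j x y).trans ?_
      rw [hVo hij, hWo hij, mul_zero, mul_zero, add_zero]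
    · change (a t : ℂ) • V i (c x) + (b t : ℂ) • W i (c x) =
        c ((a t : ℂ) • V i x + (b t : ℂ) • W i x)
      rw [hVc c hc, hWc c hc, map_add, Complex.coe_smul, Complex.coe_smul, Complex.coe_smul,
        Complex.coe_smul, map_smul, map_smul]

/-- The path from `v` ends at the reflection `cayleyLimit v` and not at the identity. Composing it
on the left with this involution makes the endpoint the identity, hence `V` itself. -/
theorem joinedIn_cayley {V : ι → H →ₗᵢ[ℂ] H} (hV : (fun i => ⇑(V i)) ∈ orthoFamilies ι 𝒞)
    (v : H →ₗᵢ[ℂ] H) (hv : ∀ c ∈ 𝒞, ∀ x, v (c x) = c (v x)) :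
    JoinedIn (orthoFamilies ι 𝒞)
      (fun i => ⇑(((cayleyLimit v).toLinearIsometry.comp v).comp (V i))) (fun i => ⇑(V i)) := by
  have hc := continuousOn_cayleyPath v
  refine JoinedIn.ofLine (f := fun r i => ⇑(((cayleyLimit v).toLinearIsometry.comp
    (cayleyPath v r)).comp (V i))) ?_ ?_ ?_ ?_
  · refine continuousOn_pi.2 fun i => continuousOn_pi.2 fun x => ?_
    exact (cayleyLimit v).continuous.comp_continuousOn (hc (V i x))
  · funext i x
    exact congrArg (cayleyLimit v) (cayleyPath_zero v (V i x))
  · funext i x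
    exact (congrArg (cayleyLimit v) (cayleyPath_one v (V i x))).trans
      (cayleyLimit_involutive v _)
  · rintro _ ⟨r, -, rfl⟩
    refine comp_mem_orthoFamilies hV _ fun c hcc x => ?_
    exact (congrArg (cayleyLimit v) (cayleyPath_comm v c (hv c hcc) r x)).trans
      (cayleyLimit_comm v c (hv c hcc) _)

/-- If there are two isometries with orthogonal ranges, then any two orthogonal families of
isometries are joined by a strongly continuous path. -/
theorem joinedIn_orthoFamilies {v₁ v₂ : H →ₗᵢ[ℂ] H} (h : ∀ x y, inner ℂ (v₁ x) (v₂ y) = 0)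
    (hv₁ : ∀ c ∈ 𝒞, ∀ x, v₁ (c x) = c (v₁ x)) (hv₂ : ∀ c ∈ 𝒞, ∀ x, v₂ (c x) = c (v₂ x))
    {V W : ι → H →ₗᵢ[ℂ] H}
    (hV : (fun i => ⇑(V i)) ∈ orthoFamilies ι 𝒞) (hW : (fun i => ⇑(W i)) ∈ orthoFamilies ι 𝒞) :
    JoinedIn (orthoFamilies ι 𝒞) (fun i => ⇑(V i)) (fun i => ⇑(W i)) := by
  -- `G` is unitary, so `G v₁` and `G v₂` still have orthogonal ranges, and `G v₂` can be deformed
  -- to the identity.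
  let G := (cayleyLimit v₂).toLinearIsometry
  have hG₁ : ∀ c ∈ 𝒞, ∀ x, G.comp v₁ (c x) = c (G.comp v₁ x) := fun c hc x =>
    (congrArg G (hv₁ c hc x)).trans (cayleyLimit_comm v₂ c (hv₂ c hc) _)
  have hG₂ : ∀ c ∈ 𝒞, ∀ x, G.comp v₂ (c x) = c (G.comp v₂ x) := fun c hc x =>
    (congrArg G (hv₂ c hc x)).trans (cayleyLimit_comm v₂ c (hv₂ c hc) _)
  have horth : ∀ x y, inner ℂ (G.comp v₁ x) (G.comp v₂ y) = 0 := fun x y =>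
    (G.inner_map_map _ _).trans (h x y)
  -- Any `U` is reached from the fixed family `G v₁ V`: rotate to `G v₂ U`, then deform to `U`.
  -- Using this for `U = V` and for `U = W` gives the path from `V` to `W`.
  have key : ∀ {U : ι → H →ₗᵢ[ℂ] H}, (fun i => ⇑(U i)) ∈ orthoFamilies ι 𝒞 →
      JoinedIn (orthoFamilies ι 𝒞) (fun i => ⇑((G.comp v₁).comp (V i))) (fun i => ⇑(U i)) :=
    fun {U} hU => (joinedIn_of_orthogonal (comp_mem_orthoFamilies hV _ hG₁)
      (comp_mem_orthoFamilies hU _ hG₂) fun i j x y => horth (V i x) (U j y)).trans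
      (joinedIn_cayley hU v₂ hv₂)
  exact (key hV).symm.trans (key hW)

end Isometries

/-! ## Homotopies from strongly continuous paths of isometries -/

section Homotopies

open Filter Topology Set

variable {A : Type u} [NonUnitalCStarAlgebra A] [GradedCStarAlgebra A]
  {H K L : Type v} [NormedAddCommGroup H] [InnerProductSpace ℂ H] [CompleteSpace H]
  [GradedHilbertSpace H]
  [NormedAddCommGroup K] [InnerProductSpace ℂ K] [CompleteSpace K] [GradedHilbertSpace K]
  [NormedAddCommGroup L] [InnerProductSpace ℂ L] [CompleteSpace L] [GradedHilbertSpace L]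

/-! ### Norm continuity of conjugation on compact operators -/

/-- Composing a strongly continuous family of isometries with a compact operator gives a norm
continuous family. -/
theorem continuous_comp_compact {X : Type*} [TopologicalSpace X] {w : X → H →ₗᵢ[ℂ] K}
    (hw : ∀ x, Continuous fun t => w t x) {T : H →L[ℂ] H} (hT : IsCompactOperator T) :
    Continuous fun t => (w t).toContinuousLinearMap ∘L T := by
  rw [continuous_iff_continuousAt]
  intro t₀
  rw [ContinuousAt, Metric.tendsto_nhds]
  intro ε hε
  have htb : TotallyBounded (T '' Metric.closedBall 0 1) :=
    ((isCompactOperator_iff_isCompact_closure_image_closedBall (T : H →ₗ[ℂ] H)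
      zero_lt_one).1 hT).totallyBounded.subset subset_closure
  -- Pointwise convergence is uniform on the finite net `s`. The isometries preserve distances, so
  -- it extends to the whole image of the unit ball at the cost of two more terms `ε / 4`.
  obtain ⟨s, hs, hcov⟩ := Metric.totallyBounded_iff.1 htb (ε / 4) (by positivity)
  have hev : ∀ᶠ t in 𝓝 t₀, ∀ y ∈ s, dist (w t y) (w t₀ y) < ε / 4 :=
    (Filter.eventually_all_finite hs).2 fun y _ =>
      Metric.tendsto_nhds.1 ((hw y).tendsto t₀) _ (by positivity)
  filter_upwards [hev] with t ht
  rw [dist_eq_norm]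
  -- A pointwise estimate bounds the operator norm only non-strictly, hence the slack of `ε / 4`.
  refine lt_of_le_of_lt (b := 3 * (ε / 4)) ?_ (by linarith)
  refine ContinuousLinearMap.opNorm_le_of_unit_norm (by positivity) fun x hx => ?_
  obtain ⟨y, hy, hxy⟩ := mem_iUnion₂.1 (hcov ⟨x, by simp [hx], rfl⟩)
  change ‖w t (T x) - w t₀ (T x)‖ ≤ _
  rw [← dist_eq_norm]
  have h1 := dist_triangle4 (w t (T x)) (w t y) (w t₀ y) (w t₀ (T x))
  rw [(w t).dist_map, (w t₀).dist_map, dist_comm y] at h1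
  have h2 : dist (T x) y < ε / 4 := hxy
  linarith [ht y hy]

open ContinuousLinearMap in
/-- Conjugation of a compact operator is norm continuous in the strong topology. -/
theorem continuous_Ad {X : Type*} [TopologicalSpace X] {E : X → EvenIsometry H K}
    (hE : ∀ x, Continuous fun t => (E t).toLinearIsometry x) (T : CompactOp H) :
    Continuous fun t => CompactOp.Ad (E t) T := by
  have h1 := continuous_comp_compact hE T.2
  have h2 := continuous_comp_compact hE (isCompactOperator_adjoint T.2)
  rw [continuous_iff_continuousAt]
  intro t₀
  rw [ContinuousAt, tendsto_iff_dist_tendsto_zero]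
  have h1' := tendsto_iff_dist_tendsto_zero.1 (h1.tendsto t₀)
  have h2' := tendsto_iff_dist_tendsto_zero.1 (h2.tendsto t₀)
  have h3 := h1'.add h2'
  rw [add_zero] at h3
  refine squeeze_zero (fun _ => dist_nonneg) (fun t => ?_) h3
  rw [dist_eq_norm, dist_eq_norm, dist_eq_norm]
  set a := (E t).toLinearIsometry
  set b := (E t₀).toLinearIsometry
  set R : H →L[ℂ] H := Subtype.val T with hR
  change ‖a.toContinuousLinearMap ∘L R ∘L adjoint a.toContinuousLinearMap -
    b.toContinuousLinearMap ∘L R ∘L adjoint b.toContinuousLinearMap‖ ≤ _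
  -- The map `t ↦ (E t)*` need not be strongly continuous. The difference is therefore split so that
  -- the variation of the adjoint appears as the adjoint of `aR* - bR*`, to which the previous lemma
  -- applies because `R*` is compact too.
  have e : a.toContinuousLinearMap ∘L R ∘L adjoint a.toContinuousLinearMap -
      b.toContinuousLinearMap ∘L R ∘L adjoint b.toContinuousLinearMap =
      (a.toContinuousLinearMap ∘L R - b.toContinuousLinearMap ∘L R) ∘L
        adjoint a.toContinuousLinearMap +
      b.toContinuousLinearMap ∘L adjoint (a.toContinuousLinearMap ∘L adjoint R -
        b.toContinuousLinearMap ∘L adjoint R) := by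
    rw [map_sub, adjoint_comp, adjoint_comp, adjoint_adjoint, comp_sub, sub_comp]
    simp only [comp_assoc]
    abel
  rw [e]
  refine (norm_add_le _ _).trans (add_le_add ?_ ?_)
  · refine (opNorm_comp_le _ _).trans (mul_le_of_le_one_right (norm_nonneg _) ?_)
    rw [LinearIsometryEquiv.norm_map]
    exact a.norm_toContinuousLinearMap_le
  · refine (opNorm_comp_le _ _).trans ?_
    rw [LinearIsometryEquiv.norm_map]
    exact mul_le_of_le_one_left (norm_nonneg _) b.norm_toContinuousLinearMap_le

theorem norm_tmul_le (a : A) (T : CompactOp H) :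
    ‖(GTensor.tmul a T : GTensor A (CompactOp H))‖ ≤ ‖a‖ * ‖T‖ := by
  rw [GTensor.tmul, GTensor.norm_of]
  refine AlgTensor.maxNorm_le (by positivity) fun D _ π => ?_
  rw [GradedCommutingPair.lift_tmul]
  exact (norm_mul_le _ _).trans (mul_le_mul (NonUnitalStarAlgHom.norm_apply_le π.left a)
    (NonUnitalStarAlgHom.norm_apply_le π.right T) (norm_nonneg _) (norm_nonneg _))

theorem tensorAd_tmul (ι : EvenIsometry H K) (a : A) (T : CompactOp H) :
    tensorAd A ι (GTensor.tmul a T) = GTensor.tmul a (CompactOp.Ad ι T) := by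
  rw [tensorAd, GTensor.tmul, GTensor.map_of]
  rfl

theorem tensorAd_zero (ι : EvenIsometry H K) :
    tensorAd A ι (0 : GTensor A (CompactOp H)) = 0 :=
  map_zero (tensorAd A ι).toNonUnitalStarAlgHom

theorem tensorAd_add (ι : EvenIsometry H K) (x y : GTensor A (CompactOp H)) :
    tensorAd A ι (x + y) = tensorAd A ι x + tensorAd A ι y :=
  map_add (tensorAd A ι).toNonUnitalStarAlgHom x y

theorem dist_tensorAd_le (ι : EvenIsometry H K) (x y : GTensor A (CompactOp H)) :
    dist (tensorAd A ι x) (tensorAd A ι y) ≤ dist x y := by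
  rw [dist_eq_norm, dist_eq_norm, ← GradedHom.coe_toHom, ← GradedHom.coe_toHom, ← map_sub]
  exact NonUnitalStarAlgHom.norm_apply_le _ _

/-- The elements `x` with this property form a closed set, because the maps `1 ⊗ Ad(E t)` are
contractions uniformly in `t`. This reduces the claim to elementary tensors, where `continuous_Ad`
and `‖a ⊗ T‖ ≤ ‖a‖‖T‖` suffice. -/
theorem continuous_tensorAd_left {X : Type*} [TopologicalSpace X] {E : X → EvenIsometry H K}
    (hE : ∀ x, Continuous fun t => (E t).toLinearIsometry x) (x : GTensor A (CompactOp H)) :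
    Continuous fun t => tensorAd A (E t) x := by
  refine GTensor.ind₁ x ?_ fun x => ?_
  · refine isClosed_of_closure_subset fun x hx => ?_
    refine continuous_of_uniform_approx_of_continuous fun U hU => ?_
    obtain ⟨ε, hε, hεU⟩ := Metric.mem_uniformity_dist.1 hU
    obtain ⟨y, hy, hxy⟩ := Metric.mem_closure_iff.1 hx ε hε
    exact ⟨_, hy, fun t => hεU ((dist_tensorAd_le _ _ _).trans_lt hxy)⟩
  · induction x using AlgTensor.induction_on with
    | zero => simp only [map_zero, tensorAd_zero]; exact continuous_const
    | add x y hx hy => simp only [map_add, tensorAd_add]; exact hx.add hy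
    | tmul a T =>
      change Continuous fun t => tensorAd A (E t) (GTensor.tmul a T)
      simp only [tensorAd_tmul]
      have h := continuous_Ad hE T
      rw [continuous_iff_continuousAt] at h ⊢
      intro t₀
      rw [ContinuousAt, tendsto_iff_dist_tendsto_zero]
      have h' := (tendsto_iff_dist_tendsto_zero.1 (h t₀)).const_mul ‖a‖
      rw [mul_zero] at h'
      refine squeeze_zero (fun _ => dist_nonneg) (fun t => ?_) h'
      rw [dist_eq_norm, dist_eq_norm]
      have hs : ∀ T T' : CompactOp K, (GTensor.tmul a T : GTensor A _) - GTensor.tmul a T' =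
          GTensor.tmul a (T - T') := fun T T' => by
        rw [sub_eq_iff_eq_add, GTensor.tmul, GTensor.tmul, GTensor.tmul, ← map_add,
          ← AlgTensor.tmul_add, sub_add_cancel]
      rw [hs]
      exact norm_tmul_le _ _

/-- Joint continuity follows from continuity in `t` for fixed `x` together with a Lipschitz constant
in `x` independent of `t`. It is needed because in a homotopy both the isometry and the homomorphism
vary. -/
theorem continuous_tensorAd {X : Type*} [TopologicalSpace X] {E : X → EvenIsometry H K}
    (hE : ∀ x, Continuous fun t => (E t).toLinearIsometry x) :
    Continuous fun p : X × GTensor A (CompactOp H) => tensorAd A (E p.1) p.2 :=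
  continuous_prod_of_continuous_lipschitzWith' _ 1
    (fun t => LipschitzWith.of_dist_le_mul fun x y => by
      simpa using dist_tensorAd_le (E t) x y) (continuous_tensorAd_left hE)

/-! ### Functoriality in the isometry, and sums along orthogonal families -/

/-- The composite of two even isometries. -/
def EvenIsometry.comp (κ : EvenIsometry K L) (ι : EvenIsometry H K) : EvenIsometry H L where
  toLinearIsometry := κ.toLinearIsometry.comp ι.toLinearIsometry
  map_parity x := (congrArg κ.toLinearIsometry (ι.map_parity x)).trans (κ.map_parity _)

variable (H) in
/-- The identity as an even isometry. -/
def EvenIsometry.id : EvenIsometry H H := ⟨LinearIsometry.id, fun _ => rfl⟩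

open ContinuousLinearMap in
theorem Ad_comp (κ : EvenIsometry K L) (ι : EvenIsometry H K) (T : CompactOp H) :
    CompactOp.Ad (κ.comp ι) T = CompactOp.Ad κ (CompactOp.Ad ι T) :=
  CompactOp.ext fun x => by
    simp only [CompactOp.Ad_val]
    have h : adjoint (κ.comp ι).toLinearIsometry.toContinuousLinearMap =
        adjoint ι.toLinearIsometry.toContinuousLinearMap ∘L
          adjoint κ.toLinearIsometry.toContinuousLinearMap := by
      rw [← adjoint_comp]
      rfl
    rw [h]
    rfl

open ContinuousLinearMap in
theorem Ad_id (T : CompactOp H) : CompactOp.Ad (EvenIsometry.id H) T = T :=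
  CompactOp.ext fun x => by
    rw [CompactOp.Ad_val]
    have h : adjoint (EvenIsometry.id H).toLinearIsometry.toContinuousLinearMap =
        ContinuousLinearMap.id ℂ H := by
      rw [← adjoint_id]
      rfl
    rw [h]
    rfl

theorem tensorAd_comp (κ : EvenIsometry K L) (ι : EvenIsometry H K)
    (x : GTensor A (CompactOp H)) :
    tensorAd A (κ.comp ι) x = tensorAd A κ (tensorAd A ι x) := by
  refine GTensor.ind₁ x (isClosed_eq (GTensor.continuous_map _ _)
    ((GTensor.continuous_map _ _).comp (GTensor.continuous_map _ _))) fun x => ?_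
  induction x using AlgTensor.induction_on with
  | zero => simp only [map_zero, tensorAd_zero]
  | add x y hx hy => simp only [map_add, tensorAd_add, hx, hy]
  | tmul a T =>
    change tensorAd A _ (GTensor.tmul a T) = tensorAd A _ (tensorAd A _ (GTensor.tmul a T))
    rw [tensorAd_tmul, tensorAd_tmul, tensorAd_tmul, Ad_comp]

theorem tensorAd_id (x : GTensor A (CompactOp H)) : tensorAd A (EvenIsometry.id H) x = x := by
  refine GTensor.ind₁ x (isClosed_eq (GTensor.continuous_map _ _) continuous_id) fun x => ?_
  induction x using AlgTensor.induction_on with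
  | zero => simp only [map_zero, tensorAd_zero]
  | add x y hx hy => simp only [map_add, tensorAd_add, hx, hy]
  | tmul a T =>
    change tensorAd A _ (GTensor.tmul a T) = GTensor.tmul a T
    rw [tensorAd_tmul, Ad_id]

open ContinuousLinearMap in
theorem Ad_mul_Ad {ι κ : EvenIsometry H K}
    (h : ∀ x y, inner ℂ (ι.toLinearIsometry x) (κ.toLinearIsometry y) = 0)
    (T T' : CompactOp H) : CompactOp.Ad ι T * CompactOp.Ad κ T' = 0 := CompactOp.ext fun x => by
  change (CompactOp.Ad ι T).val ((CompactOp.Ad κ T').val x) = 0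
  rw [CompactOp.Ad_val, CompactOp.Ad_val]
  have h' : ∀ y, adjoint ι.toLinearIsometry.toContinuousLinearMap (κ.toLinearIsometry y) = 0 :=
    fun y => ext_inner_left ℂ fun z => by
      rw [adjoint_inner_right, inner_zero_right]
      exact h z y
  rw [h', map_zero, map_zero]

/-- The sign rule splits a product of elementary tensors by the parity of the first compact factor.
An even isometry respects this splitting, so each piece has a factor `Ad(ι)(·) Ad(κ)(·)`, which
vanishes since `ι*κ = 0`. -/
theorem tensorAd_mul_eq_zero {ι κ : EvenIsometry H K}
    (h : ∀ x y, inner ℂ (ι.toLinearIsometry x) (κ.toLinearIsometry y) = 0)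
    (x y : GTensor A (CompactOp H)) : tensorAd A ι x * tensorAd A κ y = 0 := by
  refine GTensor.ind₂ x y (isClosed_eq (((GTensor.continuous_map _ _).comp continuous_fst).mul
    ((GTensor.continuous_map _ _).comp continuous_snd)) continuous_const) fun x y => ?_
  rw [tensorAd, tensorAd, GTensor.map_of, GTensor.map_of, ← GTensor.of_mul]
  rw [show AlgTensor.map (GradedHom.id A) (CompactOp.Ad ι) x *
    AlgTensor.map (GradedHom.id A) (CompactOp.Ad κ) y = 0 from ?_, map_zero]
  induction y using AlgTensor.induction_on with
  | zero => simp
  | add y y' h h' => simp only [map_add, mul_add, h, h', add_zero]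
  | tmul a' T' =>
    induction x using AlgTensor.induction_on with
    | zero => simp
    | add x x' h h' => simp only [map_add, add_mul, h, h', add_zero]
    | tmul a T =>
      have he : evenProj (CompactOp.Ad ι T) = CompactOp.Ad ι (evenProj T) :=
        (map_evenProj (CompactOp.Ad ι).toNonUnitalStarAlgHom (CompactOp.Ad ι).map_gr T).symm
      have ho : oddProj (CompactOp.Ad ι T) = CompactOp.Ad ι (oddProj T) :=
        (map_oddProj (CompactOp.Ad ι).toNonUnitalStarAlgHom (CompactOp.Ad ι).map_gr T).symm
      rw [AlgTensor.map_tmul, AlgTensor.map_tmul, AlgTensor.tmul_mul_tmul, he, ho, Ad_mul_Ad h,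
        Ad_mul_Ad h, AlgTensor.tmul_zero, AlgTensor.tmul_zero, add_zero]

/-- The sum `f ↦ ∑ᵢ (1 ⊗ Ad(Vᵢ))(φᵢ f)` of graded `*`-homomorphisms along a family of even isometries
with pairwise orthogonal ranges. -/
def familySum {ι : Type*} [Fintype ι] (V : ι → EvenIsometry H K)
    (hV : Pairwise fun i j => ∀ x y,
      inner ℂ ((V i).toLinearIsometry x) ((V j).toLinearIsometry y) = 0)
    (φ : ι → KSpace A H) : KSpace A K where
  toFun f := ∑ i, tensorAd A (V i) (φ i f)
  map_smul' c f := by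
    rw [MonoidHom.id_apply, Finset.smul_sum]
    exact Finset.sum_congr rfl fun i _ =>
      map_smul ((tensorAd A (V i)).comp (φ i)).toNonUnitalStarAlgHom c f
  map_zero' := Finset.sum_eq_zero fun i _ =>
    map_zero ((tensorAd A (V i)).comp (φ i)).toNonUnitalStarAlgHom
  map_add' f g := by
    rw [← Finset.sum_add_distrib]
    exact Finset.sum_congr rfl fun i _ =>
      map_add ((tensorAd A (V i)).comp (φ i)).toNonUnitalStarAlgHom f g
  map_mul' f g := by
    rw [Finset.sum_mul_sum]
    refine Finset.sum_congr rfl fun i _ => ?_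
    -- Orthogonality of the ranges removes the off-diagonal terms, leaving multiplicativity of each
    -- summand.
    rw [Finset.sum_eq_single i (fun j _ hj => tensorAd_mul_eq_zero (hV hj.symm) _ _)
      (fun h => absurd (Finset.mem_univ i) h)]
    exact map_mul ((tensorAd A (V i)).comp (φ i)).toNonUnitalStarAlgHom f g
  map_star' f := by
    rw [star_sum]
    exact Finset.sum_congr rfl fun i _ =>
      map_star ((tensorAd A (V i)).comp (φ i)).toNonUnitalStarAlgHom f
  map_gr' f := by
    change ∑ i, tensorAd A (V i) (φ i (gr f)) = gr (∑ i, tensorAd A (V i) (φ i f))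
    rw [map_sum]
    exact Finset.sum_congr rfl fun i _ => ((tensorAd A (V i)).comp (φ i)).map_gr f

theorem familySum_apply {ι : Type*} [Fintype ι] (V : ι → EvenIsometry H K)
    (hV : Pairwise fun i j => ∀ x y,
      inner ℂ ((V i).toLinearIsometry x) ((V j).toLinearIsometry y) = 0)
    (φ : ι → KSpace A H) (f : S) :
    familySum V hV φ f = ∑ i, tensorAd A (V i) (φ i f) := rfl

/-! ### From paths of families to based homotopies -/

variable (H) in
/-- The grading operator as a real-linear operator. -/
def parityReal : H →L[ℝ] H :=
  (parity : H →ₗᵢ[ℂ] H).toContinuousLinearMap.restrictScalars ℝ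

variable (H) in
/-- The Real structure of a Hilbert space as a real-linear operator. -/
def hconjReal [RealHilbertSpace H] : H →L[ℝ] H where
  toFun := hconj
  map_add' := map_add hconj
  map_smul' r x := by
    rw [← Complex.coe_smul, map_smulₛₗ, Complex.conj_ofReal, Complex.coe_smul, RingHom.id_apply]
  cont := hconj.continuous

/-- A joining of two orthogonal families of even isometries induces a based homotopy between the
sums along these families, inside any subspace of `𝕂(A, H)` closed under sums along families which
commute with the operators in `𝒞`. -/
theorem homotopicRel_of_joinedIn {𝒞 : Set (H →L[ℝ] H)} (hp : parityReal H ∈ 𝒞)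
    {X : Type*} [TopologicalSpace X] {j : X → KSpace A H} (hj : IsEmbedding j)
    {ι : Type*} [Fintype ι]
    (hrange : ∀ (E : ι → EvenIsometry H H), (∀ c ∈ 𝒞, ∀ i x, (E i).toLinearIsometry (c x) =
      c ((E i).toLinearIsometry x)) → ∀ (φ : ι → X) (ψ : KSpace A H),
      (∀ a, ψ a = ∑ i, tensorAd A (E i) (j (φ i) a)) → ψ ∈ range j)
    {V W : ι → EvenIsometry H H}
    (h : JoinedIn (orthoFamilies ι 𝒞) (fun i => ⇑(V i).toLinearIsometry)
      (fun i => ⇑(W i).toLinearIsometry))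
    {Y : Type*} [TopologicalSpace Y] {f g : C(Y, X)} (e : ι → C(Y, X)) (y₀ : Y)
    (he : ∀ i, j (e i y₀) = 0)
    (hf : ∀ y a, j (f y) a = ∑ i, tensorAd A (V i) (j (e i y) a))
    (hg : ∀ y a, j (g y) a = ∑ i, tensorAd A (W i) (j (e i y) a)) :
    f.HomotopicRel g {y₀} := by
  obtain ⟨γ, hγ⟩ := h
  choose U hU hUo hUc using hγ
  -- The isometries along the path are even because the grading operator belongs to `𝒞`.
  let E : unitInterval → ι → EvenIsometry H H := fun t i => ⟨U t i, hUc t _ hp i⟩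
  have hE : ∀ i x, Continuous fun t => (E t i).toLinearIsometry x := fun i x => by
    have h1 : Continuous fun t => γ t i x :=
      (continuous_apply x).comp ((continuous_apply i).comp γ.continuous)
    exact h1.congr fun t => congrFun (hU t i) x
  have hE0 : ∀ i, E 0 i = V i := fun i => by
    have h1 : U 0 i = (V i).toLinearIsometry := DFunLike.coe_injective <| by
      rw [← hU 0 i, γ.source]
    change EvenIsometry.mk _ _ = EvenIsometry.mk _ _
    simp only [h1]
  have hE1 : ∀ i, E 1 i = W i := fun i => by
    have h1 : U 1 i = (W i).toLinearIsometry := DFunLike.coe_injective <| by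
      rw [← hU 1 i, γ.target]
    change EvenIsometry.mk _ _ = EvenIsometry.mk _ _
    simp only [h1]
  -- `hrange` lifts each intermediate sum to `X`. The lifts may be chosen pointwise: `j` is an
  -- embedding, so they are unique and depend continuously on `p` as soon as their images do.
  have hF : ∀ p : unitInterval × Y, ∃ z : X,
      j z = familySum (E p.1) (hUo p.1) fun i => j (e i p.2) := fun p =>
    hrange (E p.1) (hUc p.1) (fun i => e i p.2) _ fun a => rfl
  choose F hF using hF
  have hcont : Continuous F := by
    rw [hj.continuous_iff, GradedHom.continuous_iff]
    intro a
    simp only [Function.comp_apply, hF, familySum_apply]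
    refine continuous_finsetSum _ fun i _ => ?_
    have h1 : Continuous fun p : unitInterval × Y => (p.1, j (e i p.2) a) :=
      continuous_fst.prodMk ((GradedHom.continuous_eval a).comp
        (hj.continuous.comp ((e i).continuous.comp continuous_snd)))
    have h2 := continuous_tensorAd (A := A) (E := fun t => E t i) (hE i)
    have h3 := h2.comp h1
    exact h3
  have hF0 : ∀ y, F (0, y) = f y := fun y => hj.injective <| GradedHom.ext fun a => by
    simp only [hF, familySum_apply, hE0, hf]
  have hF1 : ∀ y, F (1, y) = g y := fun y => hj.injective <| GradedHom.ext fun a => by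
    simp only [hF, familySum_apply, hE1, hg]
  -- At the base point every summand is zero, whatever the isometries, so the homotopy is stationary
  -- there.
  have hFrel : ∀ t, F (t, y₀) = f y₀ := fun t => hj.injective <| GradedHom.ext fun a => by
    simp only [hF, familySum_apply, hf, he, GradedHom.zero_apply, tensorAd_zero]
  exact ⟨⟨⟨⟨F, hcont⟩, hF0, hF1⟩, fun t y hy => by
    rw [mem_singleton_iff.1 hy]
    exact hFrel t⟩⟩

end Homotopies

/-! ## The H-monoid structure -/

section HMonoid

open Topology Set

variable {A : Type u} [NonUnitalCStarAlgebra A] [GradedCStarAlgebra A]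
  {H K : Type v} [NormedAddCommGroup H] [InnerProductSpace ℂ H] [CompleteSpace H]
  [GradedHilbertSpace H]
  [NormedAddCommGroup K] [InnerProductSpace ℂ K] [CompleteSpace K] [GradedHilbertSpace K]

/-- The restriction of `u : H ⊕ H → H` to the first summand. -/
def EvenUnitary.left (u : EvenUnitary (WithLp 2 (H × H)) H) : EvenIsometry H H :=
  u.toEvenIsometry.comp (inl H H)

/-- The restriction of `u : H ⊕ H → H` to the second summand. -/
def EvenUnitary.right (u : EvenUnitary (WithLp 2 (H × H)) H) : EvenIsometry H H :=
  u.toEvenIsometry.comp (inr H H)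

theorem EvenUnitary.inner_left_right (u : EvenUnitary (WithLp 2 (H × H)) H) (x y : H) :
    inner ℂ (u.left.toLinearIsometry x) (u.right.toLinearIsometry y) = 0 :=
  (u.toEvenIsometry.toLinearIsometry.inner_map_map _ _).trans (inner_inl_inr x y)

theorem EvenUnitary.inner_right_left (u : EvenUnitary (WithLp 2 (H × H)) H) (x y : H) :
    inner ℂ (u.right.toLinearIsometry x) (u.left.toLinearIsometry y) = 0 := by
  rw [← inner_conj_symm, u.inner_left_right, map_zero]

/-- By functoriality of `1 ⊗ Ad`, `μ_u` is the sum along the two-element orthogonal family `(u.left,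
u.right)`. -/
theorem mu_apply (u : EvenUnitary (WithLp 2 (H × H)) H) (p : KSpace A H × KSpace A H) (f : S) :
    mu A u p f = tensorAd A u.left (p.1 f) + tensorAd A u.right (p.2 f) := by
  rw [mu, GradedHom.comp_apply, sum_apply, tensorAd_add, EvenUnitary.left, EvenUnitary.right,
    tensorAd_comp, tensorAd_comp]

/-! ### The H-monoid axioms as comparisons of orthogonal families -/

/-- An even isometry commutes with the operators in `𝒞`. -/
def EvenIsometry.CommutesWith (E : EvenIsometry H H) (𝒞 : Set (H →L[ℝ] H)) : Prop :=
  ∀ c ∈ 𝒞, ∀ x, E.toLinearIsometry (c x) = c (E.toLinearIsometry x)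

theorem EvenIsometry.CommutesWith.comp {E F : EvenIsometry H H} {𝒞 : Set (H →L[ℝ] H)}
    (hE : E.CommutesWith 𝒞) (hF : F.CommutesWith 𝒞) : (E.comp F).CommutesWith 𝒞 :=
  fun c hc x => (congrArg E.toLinearIsometry (hF c hc x)).trans (hE c hc _)

/-- `μ_u` induces the structure of a commutative H-monoid on any subspace of `𝕂(A, H)` which is closed
under sums along families of isometries commuting with the operators in `𝒞`, provided that
`u` itself commutes with these operators. -/
theorem isCommutativeHMonoid_of_isEmbedding (u : EvenUnitary (WithLp 2 (H × H)) H)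
    {𝒞 : Set (H →L[ℝ] H)} (hp : parityReal H ∈ 𝒞) (hl : u.left.CommutesWith 𝒞)
    (hr : u.right.CommutesWith 𝒞)
    {X : Type w} [TopologicalSpace X] {j : X → KSpace A H} (hj : IsEmbedding j)
    (hrange : ∀ (n : ℕ) (E : Fin n → EvenIsometry H H), (∀ i, (E i).CommutesWith 𝒞) →
      ∀ (φ : Fin n → X) (ψ : KSpace A H),
        (∀ a, ψ a = ∑ i, tensorAd A (E i) (j (φ i) a)) → ψ ∈ range j)
    {e : X} (he : j e = 0) {m : X × X → X} (hm : ∀ p, j (m p) = mu A u (j p.1, j p.2)) :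
    IsCommutativeHMonoid m e := by
  have hm' : ∀ p a, j (m p) a = tensorAd A u.left (j p.1 a) + tensorAd A u.right (j p.2 a) :=
    fun p a => by rw [hm, mu_apply]
  have hcont : Continuous m := by
    rw [hj.continuous_iff, GradedHom.continuous_iff]
    intro a
    simp only [Function.comp_apply, hm']
    have h1 : Continuous fun x => j x a := (GradedHom.continuous_eval a).comp hj.continuous
    have h2 : ∀ E : EvenIsometry H H, Continuous fun x => tensorAd A E (j x a) := fun E =>
      (GTensor.continuous_map _ _).comp h1
    exact ((h2 u.left).comp continuous_fst).add ((h2 u.right).comp continuous_snd)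
  -- Any two sums with the same arguments along orthogonal families of equal length are homotopic.
  -- The pair of isometries with orthogonal ranges required for the path is `u.left`, `u.right`.
  have key : ∀ {n : ℕ} (V W : Fin n → EvenIsometry H H), (∀ i, (V i).CommutesWith 𝒞) →
      (∀ i, (W i).CommutesWith 𝒞) →
      (Pairwise fun i k => ∀ x y,
        inner ℂ ((V i).toLinearIsometry x) ((V k).toLinearIsometry y) = 0) →
      (Pairwise fun i k => ∀ x y,
        inner ℂ ((W i).toLinearIsometry x) ((W k).toLinearIsometry y) = 0) →
      ∀ {Y : Type w} [TopologicalSpace Y] {f g : C(Y, X)} (s : Fin n → C(Y, X)) (y₀ : Y),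
      (∀ i, s i y₀ = e) → (∀ y a, j (f y) a = ∑ i, tensorAd A (V i) (j (s i y) a)) →
      (∀ y a, j (g y) a = ∑ i, tensorAd A (W i) (j (s i y) a)) → f.HomotopicRel g {y₀} := by
    intro n V W hV hW hVo hWo Y _ f g s y₀ hs hf hg
    exact homotopicRel_of_joinedIn hp hj
      (fun E hE => hrange n E fun i c hc => hE c hc i)
      (joinedIn_orthoFamilies u.inner_left_right hl hr
        (V := fun i => (V i).toLinearIsometry) (W := fun i => (W i).toLinearIsometry)
        ⟨_, fun _ => rfl, hVo, fun c hc i => hV i c hc⟩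
        ⟨_, fun _ => rfl, hWo, fun c hc i => hW i c hc⟩)
      s y₀ (fun i => by rw [hs, he]) hf hg
  have hid : (EvenIsometry.id H).CommutesWith 𝒞 := fun _ _ _ => rfl
  have hm0 : m (e, e) = e := hj.injective <| GradedHom.ext fun a => by
    simp only [hm', he, GradedHom.zero_apply, tensorAd_zero, add_zero]
  -- The summand of the base point vanishes, so this is the sum along the single isometry `u.right`,
  -- compared with the sum along the identity.
  have unitl : (ContinuousMap.comp ⟨m, hcont⟩ ((ContinuousMap.const X e).prodMk
      (ContinuousMap.id X))).HomotopicRel (ContinuousMap.id X) {e} :=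
    key (fun _ : Fin 1 => u.right) (fun _ => EvenIsometry.id H) (fun _ => hr) (fun _ => hid)
      (fun i k h => absurd (Subsingleton.elim i k) h)
      (fun i k h => absurd (Subsingleton.elim i k) h) (fun _ => ContinuousMap.id X) e
      (fun _ => rfl)
      (fun y a => by
        rw [Fin.sum_univ_one]
        refine (hm' (e, y) a).trans ?_
        simp only [he, GradedHom.zero_apply, tensorAd_zero, zero_add, ContinuousMap.id_apply])
      (fun y a => by rw [Fin.sum_univ_one, tensorAd_id])
  have unitr : (ContinuousMap.comp ⟨m, hcont⟩ ((ContinuousMap.id X).prodMk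
      (ContinuousMap.const X e))).HomotopicRel (ContinuousMap.id X) {e} :=
    key (fun _ : Fin 1 => u.left) (fun _ => EvenIsometry.id H) (fun _ => hl) (fun _ => hid)
      (fun i k h => absurd (Subsingleton.elim i k) h)
      (fun i k h => absurd (Subsingleton.elim i k) h) (fun _ => ContinuousMap.id X) e
      (fun _ => rfl)
      (fun y a => by
        rw [Fin.sum_univ_one]
        refine (hm' (y, e) a).trans ?_
        simp only [he, GradedHom.zero_apply, tensorAd_zero, add_zero, ContinuousMap.id_apply])
      (fun y a => by rw [Fin.sum_univ_one, tensorAd_id])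
  have olr := u.inner_left_right
  have orl := u.inner_right_left
  refine ⟨⟨⟨m, hcont⟩, e, hm0, unitl.some, unitr.some⟩, rfl, rfl, ?_, ?_⟩
  -- Expanding the two bracketings gives these triples of words in the halves of `u`, with the three
  -- coordinates as arguments in the same order.
  · refine key ![u.left.comp u.left, u.left.comp u.right, u.right]
      ![u.left, u.right.comp u.left, u.right.comp u.right] ?_ ?_ ?_ ?_
      ![.fst, .comp .fst .snd, .comp .snd .snd] _ ?_ ?_ ?_
    · simp only [Fin.forall_fin_succ, Matrix.cons_val_zero, Matrix.cons_val_succ]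
      exact ⟨hl.comp hl, hl.comp hr, hr, fun i => i.elim0⟩
    · simp only [Fin.forall_fin_succ, Matrix.cons_val_zero, Matrix.cons_val_succ]
      exact ⟨hl, hr.comp hl, hr.comp hr, fun i => i.elim0⟩
    · intro i k hik x y
      fin_cases i <;> fin_cases k <;> first
        | exact absurd rfl hik
        | exact olr _ _
        | exact orl _ _
        | exact (u.left.toLinearIsometry.inner_map_map _ _).trans (olr _ _)
        | exact (u.left.toLinearIsometry.inner_map_map _ _).trans (orl _ _)
    · intro i k hik x y
      fin_cases i <;> fin_cases k <;> first
        | exact absurd rfl hik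
        | exact olr _ _
        | exact orl _ _
        | exact (u.right.toLinearIsometry.inner_map_map _ _).trans (olr _ _)
        | exact (u.right.toLinearIsometry.inner_map_map _ _).trans (orl _ _)
    · intro i
      fin_cases i <;> rfl
    · intro y a
      refine (hm' (m (y.1, y.2.1), y.2.2) a).trans ?_
      rw [Fin.sum_univ_three, hm', tensorAd_add, ← tensorAd_comp, ← tensorAd_comp]
      rfl
    · intro y a
      refine (hm' (y.1, m y.2) a).trans ?_
      rw [Fin.sum_univ_three, hm', tensorAd_add, ← tensorAd_comp, ← tensorAd_comp, ← add_assoc]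
      rfl
  -- Swapping the arguments amounts to swapping the isometries, because the sum in the target
  -- algebra is commutative.
  · refine key ![u.left, u.right] ![u.right, u.left] ?_ ?_ ?_ ?_ ![.fst, .snd] _ ?_ ?_ ?_
    · simp only [Fin.forall_fin_succ, Matrix.cons_val_zero, Matrix.cons_val_succ]
      exact ⟨hl, hr, fun i => i.elim0⟩
    · simp only [Fin.forall_fin_succ, Matrix.cons_val_zero, Matrix.cons_val_succ]
      exact ⟨hr, hl, fun i => i.elim0⟩
    · intro i k hik x y
      fin_cases i <;> fin_cases k <;> first
        | exact absurd rfl hik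
        | exact olr _ _
        | exact orl _ _
    · intro i k hik x y
      fin_cases i <;> fin_cases k <;> first
        | exact absurd rfl hik
        | exact olr _ _
        | exact orl _ _
    · intro i
      fin_cases i <;> rfl
    · intro y a
      refine (hm' y a).trans ?_
      rw [Fin.sum_univ_two]
      rfl
    · intro y a
      refine (hm' (y.2, y.1) a).trans ?_
      rw [Fin.sum_univ_two, add_comm]
      rfl

/-! ### The complex and the Real case -/

theorem isCommutativeHMonoid_mu (u : EvenUnitary (WithLp 2 (H × H)) H) :
    IsCommutativeHMonoid (mu A u) 0 := by
  refine isCommutativeHMonoid_of_isEmbedding (𝒞 := {parityReal H}) (j := fun φ => φ) u rfl ?_ ?_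
    .id (fun _ _ _ _ ψ _ => ⟨ψ, rfl⟩) rfl fun _ => rfl
  · rintro _ rfl x
    exact u.left.map_parity x
  · rintro _ rfl x
    exact u.right.map_parity x

/-- The same argument inside the subspace of Real homomorphisms: with the conjugation added to `𝒞`,
all isometries along the paths are Real, so the homotopies stay in this subspace. -/
theorem isCommutativeHMonoid_realMu [RealCStarAlgebra A] [RealHilbertSpace H]
    (u : EvenUnitary (WithLp 2 (H × H)) H) (hu : u.IsReal) :
    IsCommutativeHMonoid (realMu A u hu) 0 := by
  refine isCommutativeHMonoid_of_isEmbedding (𝒞 := {parityReal H, hconjReal H})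
    (j := Subtype.val) u (.inl rfl) ?_ ?_ .subtypeVal ?_ rfl fun _ => rfl
  · rintro _ (rfl | rfl) x
    · exact u.left.map_parity x
    · exact (congrArg u.toEvenIsometry.toLinearIsometry (inl_isReal x)).trans (hu _)
  · rintro _ (rfl | rfl) x
    · exact u.right.map_parity x
    · exact (congrArg u.toEvenIsometry.toLinearIsometry (inr_isReal x)).trans (hu _)
  -- A sum of Real homomorphisms along Real isometries is Real, since each `1 ⊗ Ad(E i)` commutes
  -- with the Real structures.
  · intro n E hE φ ψ hψ
    refine ⟨⟨ψ, fun a => ?_⟩, rfl⟩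
    rw [hψ, hψ, map_sum]
    refine Finset.sum_congr rfl fun i _ => ?_
    rw [(φ i).2]
    exact tensorAd_cj (E i) (fun x => hE i (hconjReal H) (.inr rfl) x) _

end HMonoid

end SpectralK
end

theorem mainTheorem11 (A : Type u) [NonUnitalCStarAlgebra A] [SpectralK.GradedCStarAlgebra A]
    (H : Type v) [NormedAddCommGroup H] [InnerProductSpace ℂ H] [CompleteSpace H]
    [TopologicalSpace.SeparableSpace H] [SpectralK.GradedHilbertSpace H]
    (h_even : ¬ FiniteDimensional ℂ (SpectralK.evenPart H))
    (h_odd : ¬ FiniteDimensional ℂ (SpectralK.oddPart H))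
    (u : SpectralK.EvenUnitary (WithLp 2 (H × H)) H) :
    SpectralK.IsCommutativeHMonoid (SpectralK.mu A u) 0 ∧
      ∀ [SpectralK.RealCStarAlgebra A] [SpectralK.RealHilbertSpace H] (hu : u.IsReal),
        SpectralK.IsCommutativeHMonoid (SpectralK.realMu A u hu) 0 :=
  ⟨SpectralK.isCommutativeHMonoid_mu u, fun hu => SpectralK.isCommutativeHMonoid_realMu u hu⟩
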